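/- For $1<p<\infty$ let $p'$ be given by $\frac1p+\frac1{p'}=1$, let $H_p^{\pm}$ be the Hardy space $H^p(\mathbb C^{\pm})$ of the upper, respectively lower, half-plane, identified through boundary functions with a closed subspace of $L_p=L_p(\mathbb R)$, and let $P^+$ be the projection of $L_p$ onto $H_p^+$ parallel to $H_p^-$. Put $\lambda_\pm(\xi)=\xi\pm i$, $r(\xi)=\frac{\xi-i}{\xi+i}$ and $\mathcal H_p^{\pm}=\lambda_\pm H_p^{\pm}$. For a function $g$ on $\mathbb R$, not necessarily bounded, $T_g\varphi_+=P^+(g\varphi_+)$ is the (possibly unbounded) Toeplitz operator with domain $\{\varphi_+\in H_p^+ : g\varphi_+\in L_p\}$, so that $\ker T_g=\{\varphi_+\in H_p^+ : g\varphi_+\in H_p^-\}$. For $n\ge 1$ let $$K_{r^n}=\operatorname{span}\Big\{\tfrac{1}{\xi+i}\,r(\xi)^j : j=0,\dots,n-1\Big\}.$$ **Theorem.** Let $1<p\le q<\infty$ and suppose that $g$ admits a $(q,p')$-factorization, i.e. $g=g_-\,r^k\,g_+$ almost everywhere on $\mathbb R$ with $k\in\mathbb Z$, with $g_\pm$ non-zero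 almost everywhere, and with $$g_-\in\mathcal H_q^-,\quad g_-^{-1}\in\mathcal H_{p'}^-,\quad g_+\in\mathcal H_{p'}^+,\quad g_+^{-1}\in\mathcal H_q^+ .$$ 1. If $g_-\in\mathcal H_p^-$ and $g_+^{-1}\in\mathcal H_p^+$, then $\ker T_g=\{0\}$ (so $\dim\ker T_g=0$) if $k\ge 0$; and if $k<0$, then $\dim\ker T_g=|k|$ and $\ker T_g=g_+^{-1}K_{r^{|k|}}$. 2. If $g_-\notin\mathcal H_p^-$ or $g_+^{-1}\notin\mathcal H_p^+$, then $\ker T_g=\{0\}$ (so $\dim\ker T_g=0$) if $k\ge -1$; and if $k\le -2$, then $\dim\ker T_g=|k|-1$ and $\ker T_g=\frac{g_+^{-1}}{\xi+i}\,K_{r^{|k|-1}}$. -/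

import Mathlib

open MeasureTheory Filter Topology
open scoped ENNReal

namespace UnboundedToeplitz

/-- `IsHardy σ p f` (used with `σ = 1` for the upper and `σ = -1` for the lower half-plane, and with
`1 ≤ p < ∞`): the function `f ∈ L_p(ℝ)` is the boundary function of an element `F` of the Hardy
space `H^p` of the half-plane `{z | 0 < σ * Im z}`, that is, `F` is analytic there, the norms
`‖F(· + iσy)‖_p`, `y > 0`, are bounded, and `F(· + iσy) → f` in `L_p(ℝ)` as `y → 0+`. -/
def IsHardy (σ : ℝ) (p : ℝ≥0∞) (f : ℝ → ℂ) : Prop :=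
  MemLp f p volume ∧
  ∃ F : ℂ → ℂ,
    DifferentiableOn ℂ F {z : ℂ | 0 < σ * z.im} ∧
    (∃ C : ℝ≥0∞, C < ∞ ∧ ∀ y : ℝ, 0 < y →
      eLpNorm (fun x : ℝ => F ((x : ℂ) + ((σ * y : ℝ) : ℂ) * Complex.I)) p volume ≤ C) ∧
    Tendsto
      (fun y : ℝ =>
        eLpNorm (fun x : ℝ => F ((x : ℂ) + ((σ * y : ℝ) : ℂ) * Complex.I) - f x) p volume)
      (𝓝[>] 0) (𝓝 0)

/-- `f ∈ 𝓗_p^± = λ_± H_p^±` with `λ_±(ξ) = ξ ± i` (`σ = ± 1`), as functions modulo null sets. -/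
def IsWeightedHardy (σ : ℝ) (p : ℝ≥0∞) (f : ℝ → ℂ) : Prop :=
  ∃ h : ℝ → ℂ, IsHardy σ p h ∧ f =ᵐ[volume] fun ξ : ℝ => ((ξ : ℂ) + (σ : ℂ) * Complex.I) * h ξ

/-- `r(ξ) = (ξ - i) / (ξ + i)`. -/
noncomputable def r (ξ : ℝ) : ℂ := ((ξ : ℂ) - Complex.I) / ((ξ : ℂ) + Complex.I)

/-- `g = g_- r^k g_+` is a `(j, s)`-factorization of `g` with index `k`. -/
structure IsFactorization (j s : ℝ≥0∞) (g gm : ℝ → ℂ) (k : ℤ) (gp : ℝ → ℂ) : Prop where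
  one_lt_left : 1 < j
  left_lt_top : j < ∞
  one_lt_right : 1 < s
  right_lt_top : s < ∞
  inv_add_inv_le : j⁻¹ + s⁻¹ ≤ 1
  eq_mul : g =ᵐ[volume] fun ξ => gm ξ * r ξ ^ k * gp ξ
  minus_ne_zero : ∀ᵐ ξ : ℝ, gm ξ ≠ 0
  plus_ne_zero : ∀ᵐ ξ : ℝ, gp ξ ≠ 0
  minus_mem : IsWeightedHardy (-1) j gm
  minus_inv_mem : IsWeightedHardy (-1) s gm⁻¹
  plus_mem : IsWeightedHardy 1 s gp
  plus_inv_mem : IsWeightedHardy 1 j gp⁻¹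

/-- The model space `K_{r^n}`, spanned by `(ξ + i)⁻¹ r(ξ)^j`, `j = 0, …, n - 1`. -/
noncomputable def modelSpace (n : ℕ) : Submodule ℂ (ℝ → ℂ) :=
  Submodule.span ℂ
    (Set.range fun (j : Fin n) (ξ : ℝ) => 1 / ((ξ : ℂ) + Complex.I) * r ξ ^ (j : ℕ))

theorem IsHardy.congr {σ : ℝ} {p : ℝ≥0∞} {f g : ℝ → ℂ} (hf : IsHardy σ p f)
    (h : f =ᵐ[volume] g) : IsHardy σ p g := by
  obtain ⟨hm, F, hF, hC, hT⟩ := hf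
  refine ⟨hm.ae_eq h, F, hF, hC, hT.congr fun y => eLpNorm_congr_ae ?_⟩
  filter_upwards [h] with x hx
  rw [hx]

theorem IsHardy.zero (σ : ℝ) (p : ℝ≥0∞) : IsHardy σ p (0 : ℝ → ℂ) :=
  ⟨MemLp.zero, 0, differentiableOn_const 0, ⟨0, by simp, by simp⟩, by simp⟩

theorem aestronglyMeasurable_slice {σ : ℝ} (hσ : σ * σ = 1) {F : ℂ → ℂ}
    (hF : DifferentiableOn ℂ F {z : ℂ | 0 < σ * z.im}) {y : ℝ} (hy : 0 < y) :
    AEStronglyMeasurable (fun x : ℝ => F ((x : ℂ) + ((σ * y : ℝ) : ℂ) * Complex.I)) volume := by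
  refine Continuous.aestronglyMeasurable (hF.continuousOn.comp_continuous (by fun_prop) fun x => ?_)
  have h : σ * (σ * y) = y := by rw [← mul_assoc, hσ, one_mul]
  simpa [h] using hy

theorem IsHardy.add {σ : ℝ} (hσ : σ * σ = 1) {p : ℝ≥0∞} {f g : ℝ → ℂ} (hf : IsHardy σ p f)
    (hg : IsHardy σ p g) : IsHardy σ p (f + g) := by
  obtain ⟨hfm, F, hF, ⟨C, hC, hFC⟩, hFT⟩ := hf
  obtain ⟨hgm, G, hG, ⟨D, hD, hGD⟩, hGT⟩ := hg
  refine ⟨hfm.add hgm, F + G, hF.add hG, ⟨ENNReal.LpAddConst p * (C + D), ?_, fun y hy => ?_⟩, ?_⟩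
  · exact ENNReal.mul_lt_top (ENNReal.LpAddConst_lt_top p) (ENNReal.add_lt_top.2 ⟨hC, hD⟩)
  · refine (eLpNorm_add_le' (aestronglyMeasurable_slice hσ hF hy)
      (aestronglyMeasurable_slice hσ hG hy) p).trans ?_
    gcongr
    exacts [hFC y hy, hGD y hy]
  · have h0 := ENNReal.Tendsto.const_mul (a := ENNReal.LpAddConst p) (hFT.add hGT)
      (Or.inr (ENNReal.LpAddConst_lt_top p).ne)
    rw [add_zero, mul_zero] at h0
    refine tendsto_of_tendsto_of_tendsto_of_le_of_le' tendsto_const_nhds h0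
      (Eventually.of_forall fun _ => zero_le) ?_
    filter_upwards [self_mem_nhdsWithin] with y hy
    refine le_trans (le_of_eq ?_) (eLpNorm_add_le'
      ((aestronglyMeasurable_slice hσ hF hy).sub hfm.1)
      ((aestronglyMeasurable_slice hσ hG hy).sub hgm.1) p)
    congr 1
    funext x
    simp only [Pi.add_apply, Pi.sub_apply]
    ring

theorem IsHardy.smul {σ : ℝ} {p : ℝ≥0∞} {f : ℝ → ℂ} (c : ℂ) (hf : IsHardy σ p f) :
    IsHardy σ p (c • f) := by
  obtain ⟨hfm, F, hF, ⟨C, hC, hFC⟩, hFT⟩ := hf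
  refine ⟨hfm.const_smul c, c • F, hF.const_smul c, ⟨‖c‖ₑ * C, ?_, fun y hy => ?_⟩, ?_⟩
  · exact ENNReal.mul_lt_top (by simp) hC
  · refine le_trans (le_of_eq ?_) (mul_le_mul_right (hFC y hy) ‖c‖ₑ)
    rw [← eLpNorm_const_smul]
    rfl
  · have h0 := ENNReal.Tendsto.const_mul (a := ‖c‖ₑ) hFT (Or.inr (by simp))
    rw [mul_zero] at h0
    refine h0.congr fun y => ?_
    rw [← eLpNorm_const_smul]
    congr 1
    funext x
    simp [mul_sub]

/-- The Hardy space `H_p^+` (`σ = 1`) or `H_p^-` (`σ = -1`) as a subspace of `L_p(ℝ)`. -/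
def hardySpace (σ : ℝ) (hσ : σ * σ = 1) (p : ℝ≥0∞) :
    Submodule ℂ (Lp ℂ p (volume : Measure ℝ)) where
  carrier := {f | IsHardy σ p f}
  zero_mem' := (IsHardy.zero σ p).congr (Lp.coeFn_zero ℂ p volume).symm
  add_mem' {a b} ha hb := (IsHardy.add hσ ha hb).congr (Lp.coeFn_add a b).symm
  smul_mem' c a ha := (IsHardy.smul c ha).congr (Lp.coeFn_smul c a).symm

/-- `H_p^+ = H^p(ℂ^+)`, as a subspace of `L_p(ℝ)`. -/
def hardyPlus (p : ℝ≥0∞) : Submodule ℂ (Lp ℂ p (volume : Measure ℝ)) :=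
  hardySpace 1 (by norm_num) p

/-- `H_p^- = H^p(ℂ^-)`, as a subspace of `L_p(ℝ)`. -/
def hardyMinus (p : ℝ≥0∞) : Submodule ℂ (Lp ℂ p (volume : Measure ℝ)) :=
  hardySpace (-1) (by norm_num) p

/-- The graph of the projection `P^+` of `L_p(ℝ)` onto `H_p^+` parallel to `H_p^-`:
`P^+ h = ψ` means `ψ ∈ H_p^+` and `h - ψ ∈ H_p^-`. -/
def IsRieszProj (p : ℝ≥0∞) (h ψ : Lp ℂ p (volume : Measure ℝ)) : Prop :=
  ψ ∈ hardyPlus p ∧ h - ψ ∈ hardyMinus p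

/-- The graph of the (possibly unbounded) Toeplitz operator `T_g`: its domain consists of the
`φ ∈ H_p^+` for which `g φ` is (the class of) a function `h ∈ L_p(ℝ)`, and `T_g φ = P^+ h`. -/
def toeplitzGraph (p : ℝ≥0∞) (g : ℝ → ℂ) :
    Submodule ℂ (Lp ℂ p (volume : Measure ℝ) × Lp ℂ p (volume : Measure ℝ)) where
  carrier := {x | x.1 ∈ hardyPlus p ∧ ∃ h : Lp ℂ p (volume : Measure ℝ),
    (h =ᵐ[volume] fun ξ => g ξ * x.1 ξ) ∧ IsRieszProj p h x.2}
  zero_mem' := by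
    refine ⟨zero_mem _, 0, ?_, zero_mem _, ?_⟩
    · filter_upwards [Lp.coeFn_zero ℂ p (volume : Measure ℝ)] with ξ _
      simp
    · simp
  add_mem' := by
    rintro a b ⟨ha, h, hh, h1, h2⟩ ⟨hb, h', hh', h1', h2'⟩
    refine ⟨add_mem ha hb, h + h', ?_, add_mem h1 h1', ?_⟩
    · filter_upwards [hh, hh', Lp.coeFn_add h h', Lp.coeFn_add a.1 b.1] with ξ e1 e2 e3 e4
      rw [Prod.fst_add, e3, e4, Pi.add_apply, Pi.add_apply, e1, e2, mul_add]
    · have e : h + h' - (a + b).2 = (h - a.2) + (h' - b.2) := by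
        rw [Prod.snd_add]; abel
      rw [e]
      exact add_mem h2 h2'
  smul_mem' := by
    rintro c a ⟨ha, h, hh, h1, h2⟩
    refine ⟨Submodule.smul_mem _ c ha, c • h, ?_, Submodule.smul_mem _ c h1, ?_⟩
    · filter_upwards [hh, Lp.coeFn_smul c h, Lp.coeFn_smul c a.1] with ξ e1 e2 e3
      simp only [Prod.smul_fst, e2, e3, Pi.smul_apply, e1, smul_eq_mul]
      ring
    · have e : c • h - (c • a).2 = c • (h - a.2) := by
        rw [Prod.smul_snd, smul_sub]
      rw [e]
      exact Submodule.smul_mem _ c h2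

/-- `ker T_g`: all `φ ∈ H_p^+` in the domain of `T_g` with `T_g φ = 0`. -/
noncomputable def toeplitzKer (p : ℝ≥0∞) (g : ℝ → ℂ) : Submodule ℂ (Lp ℂ p (volume : Measure ℝ)) :=
  (toeplitzGraph p g).comap (LinearMap.inl ℂ _ _)

/-- Equality, modulo null sets, of a subspace `M` of `L_p(ℝ)` with the space
`w K = {w κ : κ ∈ K}` of functions on `ℝ` (this includes `w κ ∈ L_p(ℝ)` for all `κ ∈ K`). -/
def EqMulSpace {p : ℝ≥0∞} (M : Submodule ℂ (Lp ℂ p (volume : Measure ℝ))) (w : ℝ → ℂ)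
    (K : Submodule ℂ (ℝ → ℂ)) : Prop :=
  {f : ℝ → ℂ | ∃ φ ∈ M, f =ᵐ[volume] φ} =
    {f : ℝ → ℂ | ∃ κ ∈ K, f =ᵐ[volume] fun ξ => w ξ * κ ξ}

end UnboundedToeplitz

/-!
Write `h_+ = g_+⁻¹ / (ξ + i)` and `h_- = g_- / (ξ - i)`; these are boundary functions in `H_q^+`
and `H_q^-`, and the factorization is of the kind required for `p` exactly when both lie in `L_p`.

The basic tool is a description of Hardy spaces on the boundary that does not mention the exponent:
for `1 ≤ p < ∞`, a function in `L_p` belongs to `H_p^+` if and only if it annihilates all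
Cauchy kernels `(t - w)⁻¹` with `w` in the lower half-plane (`IsHardy.cauchyVanishes`,
`CauchyVanishes.isHardy`). One direction is Cauchy's theorem; for the other, the Cauchy transform
of such a function is its Poisson extension, and Poisson kernels form an approximate identity in
`L_p`. Consequently `H_q^± ∩ L_p ⊆ H_p^±` (`IsHardy.of_memLp`) and `H_1^+ ∩ H_1^- = {0}`
(`ae_eq_zero_of_cauchyVanishes`).

If `φ ∈ ker T_g`, then by Hölder's inequality `u = g_+ φ / (ξ + i)` and `v = g_-⁻¹ g φ / (ξ - i)`
are in `H_1^+` and `H_1^-`, and `u = r^(1-k) v`. Removing zeros of `u` at `i` one by one shows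
`u = R(r) / (ξ + i)²` for a polynomial `R` of degree less than `max (-k) 0`
(`exists_polynomial_of_eq_r_pow_mul`), so `φ = h_+ R(r)`. In particular the kernel is trivial for
`k ≥ 0`.

Conversely, for `k = -(m + 1)` and `R` of degree at most `m`, the function `φ = h_+ R(r)` has
`g φ = h_- R(r) r^(-m)`, where `R(r)` and `R(r) r^(-m)` are bounded analytic in the upper and lower
half-plane. Hence `φ ∈ ker T_g` if and only if `h_+ R(r)` and `h_- R(r)` lie in `L_p`. This holds
for all `R` if `h_±` lie in `L_p`. In general it holds if `R(1) = 0`, because `1 - r = 2i / (ξ + i)`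
and multiplication by `(ξ + i)⁻¹` maps `L_q` to `L_p` (`memLp_mul_eval_r_of_isRoot`); and if it
holds for some `R` with `R(1) ≠ 0`, then `h_±` lie in `L_p` (`memLp_of_memLp_mul_eval_r`). So in the
second case the kernel consists of the `h_+ R(r)` with `R` divisible by `X - 1`.
-/

namespace UnboundedToeplitz

/-! ### Algebra of Hardy spaces and Cauchy kernels -/

theorem eLpNorm_mul_le {p q s : ℝ≥0∞} [ENNReal.HolderTriple p q s] {u v : ℝ → ℂ}
    (hu : AEStronglyMeasurable u volume) (hv : AEStronglyMeasurable v volume) :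
    eLpNorm (u * v) s volume ≤ eLpNorm u p volume * eLpNorm v q volume := by
  simpa using! (eLpNorm_le_eLpNorm_mul_eLpNorm_of_nnnorm (p := p) (q := q) (r := s) hu hv
    (fun a b => a * b) 1 (.of_forall fun _ => by simp) : _)

/-- Products of boundary functions; `s`, `p` or `q` may be `∞`, in which case `IsHardy` demands
uniform convergence of the slices to the boundary function. -/
theorem IsHardy.mul {σ : ℝ} (hσ : σ * σ = 1) {p q s : ℝ≥0∞} [ENNReal.HolderTriple p q s]
    {f g : ℝ → ℂ} (hf : IsHardy σ p f) (hg : IsHardy σ q g) :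
    IsHardy σ s (fun x => f x * g x) := by
  obtain ⟨hfm, F, hF, ⟨C, hC, hFC⟩, hFT⟩ := hf
  obtain ⟨hgm, G, hG, ⟨D, hD, hGD⟩, hGT⟩ := hg
  refine ⟨hgm.mul' hfm, F * G, hF.mul hG, ⟨C * D, ENNReal.mul_lt_top hC hD, fun y hy => ?_⟩, ?_⟩
  · refine (eLpNorm_mul_le (p := p) (q := q) (aestronglyMeasurable_slice hσ hF hy)
      (aestronglyMeasurable_slice hσ hG hy)).trans ?_
    gcongr
    exacts [hFC y hy, hGD y hy]
  · have h1 := ENNReal.Tendsto.const_mul (a := C) hGT (Or.inr hC.ne)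
    have h2 := ENNReal.Tendsto.mul_const (b := eLpNorm g q volume) hFT
      (Or.inr hgm.eLpNorm_ne_top)
    have h0 := ENNReal.Tendsto.const_mul (a := ENNReal.LpAddConst s) (h1.add h2)
      (Or.inr (ENNReal.LpAddConst_lt_top s).ne)
    simp only [mul_zero, zero_mul, add_zero] at h0
    refine tendsto_of_tendsto_of_tendsto_of_le_of_le' tendsto_const_nhds h0
      (Eventually.of_forall fun _ => zero_le) ?_
    filter_upwards [self_mem_nhdsWithin] with y hy
    have hFs := aestronglyMeasurable_slice hσ hF hy
    have hGs := aestronglyMeasurable_slice hσ hG hy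
    refine le_trans (le_of_eq ?_) ((eLpNorm_add_le' (hFs.mul (hGs.sub hgm.1))
      ((hFs.sub hfm.1).mul hgm.1) s).trans ?_)
    · congr 1
      funext x
      simp only [Pi.add_apply, Pi.sub_apply, Pi.mul_apply]
      ring
    · gcongr
      · refine (eLpNorm_mul_le (p := p) (q := q) hFs (hGs.sub hgm.1)).trans ?_
        gcongr
        exacts [hFC y hy, le_rfl]
      · exact eLpNorm_mul_le (hFs.sub hfm.1) hgm.1

/-- The reflection `ξ ↦ -ξ` interchanges the Hardy spaces of the two half-planes. -/
theorem IsHardy.comp_neg {σ : ℝ} {p : ℝ≥0∞} {f : ℝ → ℂ} (hf : IsHardy σ p f) :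
    IsHardy (-σ) p (fun x => f (-x)) := by
  obtain ⟨hfm, F, hF, ⟨C, hC, hFC⟩, hFT⟩ := hf
  have mp : MeasurePreserving (fun x : ℝ => -x) volume volume :=
    Measure.measurePreserving_neg volume
  have hcomp : ∀ u : ℝ → ℂ, eLpNorm (fun x => u (-x)) p volume = eLpNorm u p volume := by
    intro u
    conv_rhs => rw [← mp.map_eq]
    exact ((MeasurableEquiv.neg ℝ).measurableEmbedding.eLpNorm_map_measure).symm
  have hslice : ∀ (x y : ℝ), -((x : ℂ) + ((-σ * y : ℝ) : ℂ) * Complex.I) =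
      ((-x : ℝ) : ℂ) + ((σ * y : ℝ) : ℂ) * Complex.I := by
    intro x y
    push_cast
    ring
  refine ⟨hfm.comp_measurePreserving mp, fun z => F (-z), ?_, ⟨C, hC, fun y hy => ?_⟩, ?_⟩
  · refine hF.comp differentiableOn_id.neg fun z hz => ?_
    simpa using hz
  · simp only [hslice]
    rw [hcomp fun x => F ((x : ℂ) + ((σ * y : ℝ) : ℂ) * Complex.I)]
    exact hFC y hy
  · simp only [hslice]
    refine hFT.congr fun y => ?_
    rw [← hcomp]

theorem IsHardy.const (σ : ℝ) (c : ℂ) : IsHardy σ ∞ (fun _ => c) :=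
  ⟨memLp_top_const c, fun _ => c, differentiableOn_const c,
    ⟨eLpNorm (fun _ : ℝ => c) ∞ volume, (memLp_top_const c).eLpNorm_lt_top, fun _ _ => le_rfl⟩,
    tendsto_const_nhds.congr fun _ => by simp [← Pi.zero_def]⟩

theorem sub_ne_zero_of_im_ne_zero {w : ℂ} (hw : w.im ≠ 0) (t : ℝ) : (t : ℂ) - w ≠ 0 := by
  intro h
  apply hw
  simpa using congrArg Complex.im h

theorem abs_im_le_norm_ofReal_sub (w : ℂ) (t : ℝ) : |w.im| ≤ ‖(t : ℂ) - w‖ := by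
  simpa using Complex.abs_im_le_norm ((t : ℂ) - w)

theorem continuous_resolvent {w : ℂ} (hw : w.im ≠ 0) :
    Continuous fun t : ℝ => ((t : ℂ) - w)⁻¹ :=
  (by fun_prop : Continuous fun t : ℝ => (t : ℂ) - w).inv₀ (sub_ne_zero_of_im_ne_zero hw)

theorem memLp_resolvent {w : ℂ} (hw : w.im ≠ 0) {s : ℝ≥0∞} (hs : 1 < s) :
    MemLp (fun t : ℝ => ((t : ℂ) - w)⁻¹) s volume := by
  have key : MemLp (fun t : ℝ => (1 + ‖t‖)⁻¹) s volume := by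
    have hm : AEStronglyMeasurable (fun t : ℝ => (1 + ‖t‖)⁻¹) volume :=
      (by fun_prop : Measurable fun t : ℝ => (1 + ‖t‖)⁻¹).aestronglyMeasurable
    rcases eq_or_ne s ∞ with rfl | hs'
    · refine memLp_top_of_bound hm 1 (Eventually.of_forall fun t => ?_)
      rw [Real.norm_of_nonneg (by positivity)]
      exact inv_le_one_of_one_le₀ (by linarith [norm_nonneg t])
    · rw [← integrable_norm_rpow_iff hm (zero_lt_one.trans hs).ne' hs']
      have h1 : 1 < s.toReal := by
        rw [← ENNReal.toReal_one]
        exact (ENNReal.toReal_lt_toReal ENNReal.one_ne_top hs').2 hs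
      have := integrable_one_add_norm (E := ℝ) (μ := volume) (r := s.toReal) (by simpa using h1)
      refine this.congr (Eventually.of_forall fun t => ?_)
      have h0 : 0 ≤ 1 + ‖t‖ := by positivity
      simp only [norm_inv, Real.norm_of_nonneg h0, Real.inv_rpow h0, Real.rpow_neg h0]
  have h0 : 0 < |w.im| := abs_pos.2 hw
  refine key.of_le_mul (c := (1 + ‖w‖) / |w.im| + 1)
    (continuous_resolvent hw).aestronglyMeasurable (Eventually.of_forall fun t => ?_)
  have h1 : 0 < ‖(t : ℂ) - w‖ := norm_pos_iff.2 (sub_ne_zero_of_im_ne_zero hw t)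
  have h2 : ‖t‖ ≤ ‖(t : ℂ) - w‖ + ‖w‖ := by
    simpa using norm_add_le ((t : ℂ) - w) w
  have h3 : 1 + ‖w‖ ≤ (1 + ‖w‖) / |w.im| * ‖(t : ℂ) - w‖ := by
    rw [div_mul_eq_mul_div, le_div_iff₀ h0]
    gcongr
    exact abs_im_le_norm_ofReal_sub w t
  rw [norm_inv, norm_inv, Real.norm_of_nonneg (by positivity : 0 ≤ 1 + ‖t‖), ← div_eq_mul_inv,
    inv_le_comm₀ h1 (by positivity), inv_div, div_le_iff₀ (by positivity)]
  linarith

/-- Cauchy kernels with pole in the opposite half-plane belong to `H^s` for `1 < s ≤ ∞`. -/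
theorem IsHardy.resolvent {σ : ℝ} (hσ : σ * σ = 1) {w : ℂ} (hw : σ * w.im < 0) {s : ℝ≥0∞}
    (hs : 1 < s) : IsHardy σ s (fun t => ((t : ℂ) - w)⁻¹) := by
  have hw0 : w.im ≠ 0 := by rintro h; simp [h] at hw
  have hm := memLp_resolvent hw0 hs
  -- moving away from the pole only increases the distance to it
  have hle : ∀ y : ℝ, 0 < y → ∀ x : ℝ,
      ‖(x : ℂ) - w‖ ≤ ‖(x : ℂ) + ((σ * y : ℝ) : ℂ) * Complex.I - w‖ := by
    intro y hy x
    rw [Complex.norm_def, Complex.norm_def]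
    apply Real.sqrt_le_sqrt
    simp only [Complex.normSq_apply, Complex.sub_re, Complex.add_re, Complex.ofReal_re,
      Complex.re_ofReal_mul, Complex.I_re, Complex.sub_im, Complex.add_im, Complex.ofReal_im,
      Complex.im_ofReal_mul, Complex.I_im]
    nlinarith [mul_pos hy (neg_pos.2 hw), mul_pos hy hy]
  have hpos : ∀ x : ℝ, 0 < ‖(x : ℂ) - w‖ := fun x =>
    norm_pos_iff.2 (sub_ne_zero_of_im_ne_zero hw0 x)
  refine ⟨hm, fun z => (z - w)⁻¹, ?_, ⟨_, hm.eLpNorm_lt_top, fun y hy => ?_⟩, ?_⟩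
  · refine DifferentiableOn.inv (by fun_prop) fun z hz h => ?_
    rw [sub_eq_zero.1 h] at hz
    exact (lt_asymm hw hz)
  · refine eLpNorm_mono fun x => ?_
    rw [norm_inv, norm_inv]
    exact inv_anti₀ (hpos x) (hle y hy x)
  · have h0 : Tendsto (fun y : ℝ => ENNReal.ofReal (y / |w.im|) *
        eLpNorm (fun t : ℝ => ((t : ℂ) - w)⁻¹) s volume) (𝓝[>] 0) (𝓝 0) := by
      have h1 : Tendsto (fun y : ℝ => ENNReal.ofReal (y / |w.im|)) (𝓝[>] 0) (𝓝 0) := by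
        refine tendsto_nhdsWithin_of_tendsto_nhds ?_
        have : Continuous fun y : ℝ => ENNReal.ofReal (y / |w.im|) :=
          ENNReal.continuous_ofReal.comp (by fun_prop)
        simpa using this.tendsto 0
      simpa using ENNReal.Tendsto.mul_const h1 (Or.inr hm.eLpNorm_ne_top)
    refine tendsto_of_tendsto_of_tendsto_of_le_of_le' tendsto_const_nhds h0
      (Eventually.of_forall fun _ => zero_le) ?_
    filter_upwards [self_mem_nhdsWithin] with y hy
    rw [Set.mem_Ioi] at hy
    refine eLpNorm_le_mul_eLpNorm_of_ae_le_mul (Eventually.of_forall fun x => ?_) s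
    have e1 := norm_pos_iff.1 (hpos x)
    have e2 := norm_pos_iff.1 ((hpos x).trans_le (hle y hy x))
    have e : ((x : ℂ) + ((σ * y : ℝ) : ℂ) * Complex.I - w)⁻¹ - ((x : ℂ) - w)⁻¹
        = -(((σ * y : ℝ) : ℂ) * Complex.I) *
          ((x : ℂ) + ((σ * y : ℝ) : ℂ) * Complex.I - w)⁻¹ * ((x : ℂ) - w)⁻¹ := by
      field_simp
      ring
    have hσ1 : |σ| = 1 := by
      have := abs_mul_abs_self σ
      nlinarith [abs_nonneg σ]
    rw [e, norm_mul, norm_mul, norm_neg, norm_mul, Complex.norm_I, mul_one, Complex.norm_real,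
      Real.norm_eq_abs, abs_mul, hσ1, one_mul, abs_of_pos hy, norm_inv _, div_eq_mul_inv]
    gcongr
    exact (abs_im_le_norm_ofReal_sub w x).trans (hle y hy x)

/-! ### Boundary functions annihilate Cauchy kernels -/

theorem integrable_of_eLpNorm_one_le {u : ℝ → ℂ} {C : ℝ≥0∞} (hC : C < ∞)
    (hu : AEStronglyMeasurable u volume) (h : eLpNorm u 1 volume ≤ C) :
    Integrable u ∧ ∫ x, ‖u x‖ ≤ C.toReal := by
  have hi : Integrable u := memLp_one_iff_integrable.1 ⟨hu, h.trans_lt hC⟩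
  refine ⟨hi, ?_⟩
  rw [integral_norm_eq_lintegral_enorm hu, ← eLpNorm_one_eq_lintegral_enorm]
  exact ENNReal.toReal_mono hC.ne h

/-- The horizontal integrals of an analytic function in the upper half-plane with uniformly bounded
horizontal `L_1` norms do not depend on the height: in the Cauchy theorem for rectangles, the
vertical sides contribute an integrable function of the half-width, so its limit is zero. -/
theorem integral_slice_eq {G : ℂ → ℂ} (hG : DifferentiableOn ℂ G {z : ℂ | 0 < z.im}) {C : ℝ≥0∞}
    (hC : C < ∞)
    (hGC : ∀ y : ℝ, 0 < y → eLpNorm (fun x : ℝ => G ((x : ℂ) + (y : ℂ) * Complex.I)) 1 volume ≤ C)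
    {a b : ℝ} (ha : 0 < a) (hab : a ≤ b) :
    ∫ x : ℝ, G ((x : ℂ) + (a : ℂ) * Complex.I) = ∫ x : ℝ, G ((x : ℂ) + (b : ℂ) * Complex.I) := by
  have hcont : ∀ y : ℝ, 0 < y → Continuous fun x : ℝ => G ((x : ℂ) + (y : ℂ) * Complex.I) :=
    fun y hy => hG.continuousOn.comp_continuous (by fun_prop) fun x => by simpa using hy
  have hint : ∀ y : ℝ, 0 < y → Integrable (fun x : ℝ => G ((x : ℂ) + (y : ℂ) * Complex.I)) ∧
      ∫ x : ℝ, ‖G ((x : ℂ) + (y : ℂ) * Complex.I)‖ ≤ C.toReal := fun y hy =>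
    integrable_of_eLpNorm_one_le hC (hcont y hy).aestronglyMeasurable (hGC y hy)
  have hb : 0 < b := ha.trans_le hab
  have hmeas : AEStronglyMeasurable (fun z : ℝ × ℝ => G ((z.1 : ℂ) + (z.2 : ℂ) * Complex.I))
      ((volume : Measure ℝ).prod (volume.restrict (Set.Ioc a b))) := by
    have : (volume : Measure ℝ).prod (volume.restrict (Set.Ioc a b)) =
        ((volume : Measure ℝ).prod volume).restrict (Set.univ ×ˢ Set.Ioc a b) := by
      rw [← Measure.prod_restrict, Measure.restrict_univ]
    rw [this]
    refine ContinuousOn.aestronglyMeasurable (hG.continuousOn.comp (by fun_prop) fun z hz => ?_)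
      (MeasurableSet.univ.prod measurableSet_Ioc)
    simpa using ha.trans hz.2.1
  have hprod : Integrable (fun z : ℝ × ℝ => G ((z.1 : ℂ) + (z.2 : ℂ) * Complex.I))
      ((volume : Measure ℝ).prod (volume.restrict (Set.Ioc a b))) := by
    rw [integrable_prod_iff' hmeas]
    refine ⟨(ae_restrict_iff' measurableSet_Ioc).2
      (Eventually.of_forall fun y hy => (hint y (ha.trans hy.1)).1), ?_⟩
    refine Integrable.of_bound hmeas.norm.prod_swap.integral_prod_right' C.toReal
      ((ae_restrict_iff' measurableSet_Ioc).2 (Eventually.of_forall fun y hy => ?_))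
    rw [Real.norm_of_nonneg (integral_nonneg fun _ => norm_nonneg _)]
    exact (hint y (ha.trans hy.1)).2
  set S : ℝ → ℂ := fun x => ∫ y in a..b, G ((x : ℂ) + (y : ℂ) * Complex.I) with hS
  have hSint : Integrable S := by
    refine hprod.integral_prod_left.congr (Eventually.of_forall fun x => ?_)
    simp only [hS, intervalIntegral.integral_of_le hab]
  have hD : Integrable fun T => S T - S (-T) := hSint.sub hSint.comp_neg
  have hrect : ∀ T : ℝ, S T - S (-T) =
      Complex.I * ((∫ x in (-T)..T, G ((x : ℂ) + (a : ℂ) * Complex.I)) -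
        ∫ x in (-T)..T, G ((x : ℂ) + (b : ℂ) * Complex.I)) := by
    intro T
    have := Complex.integral_boundary_rect_eq_zero_of_differentiableOn G
      (((-T : ℝ) : ℂ) + (a : ℂ) * Complex.I) ((T : ℂ) + (b : ℂ) * Complex.I) (hG.mono fun z hz => by
        have h2 := hz.2
        simp only [Set.mem_preimage, Complex.add_im, Complex.ofReal_im, Complex.mul_im,
          Complex.ofReal_re, Complex.I_im, Complex.I_re, mul_one, mul_zero, add_zero,
          zero_add, Set.uIcc_of_le hab] at h2
        exact ha.trans_le h2.1)
    simp only [Complex.add_re, Complex.ofReal_re, Complex.mul_re, Complex.I_re, mul_zero,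
      Complex.ofReal_im, Complex.I_im, mul_one, sub_self, add_zero, Complex.add_im,
      Complex.mul_im, zero_add, smul_eq_mul] at this
    simp only [hS]
    linear_combination (-Complex.I) * this + (S T - S (-T)) * Complex.I_sq
  have hlim : Tendsto (fun T => S T - S (-T)) atTop
      (𝓝 (Complex.I * ((∫ x : ℝ, G ((x : ℂ) + (a : ℂ) * Complex.I)) -
        ∫ x : ℝ, G ((x : ℂ) + (b : ℂ) * Complex.I)))) := by
    simp only [hrect]
    exact ((intervalIntegral_tendsto_integral (hint a ha).1 tendsto_neg_atTop_atBot
      tendsto_id).sub (intervalIntegral_tendsto_integral (hint b hb).1 tendsto_neg_atTop_atBot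
      tendsto_id)).const_mul _
  have h0 := IntegrableAtFilter.eq_zero_of_tendsto (μ := volume) (hD.integrableAtFilter atTop)
    (fun s hs => by
      obtain ⟨c, hc⟩ := mem_atTop_sets.1 hs
      exact top_unique (Real.volume_Ici (a := c) ▸ measure_mono hc)) hlim
  simpa [sub_eq_zero] using h0

/-- `f` is orthogonal to all Cauchy kernels `(t - w)⁻¹` with pole `w` in the half-plane opposite to
`{z | 0 < σ * Im z}`. For `f ∈ L_p(ℝ)`, `1 ≤ p < ∞`, this describes the boundary functions
of the Hardy space of `{z | 0 < σ * Im z}`, and it does not mention `p`. -/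
def CauchyVanishes (σ : ℝ) (f : ℝ → ℂ) : Prop :=
  ∀ w : ℂ, σ * w.im < 0 → ∫ t : ℝ, f t * ((t : ℂ) - w)⁻¹ = 0

theorem norm_resolvent_le {w : ℂ} (hw : w.im ≠ 0) (t : ℝ) : ‖((t : ℂ) - w)⁻¹‖ ≤ |w.im|⁻¹ := by
  rw [norm_inv]
  exact inv_anti₀ (abs_pos.2 hw) (abs_im_le_norm_ofReal_sub w t)

theorem integrable_mul_resolvent {f : ℝ → ℂ} (hf : Integrable f) {w : ℂ} (hw : w.im ≠ 0) :
    Integrable fun t : ℝ => f t * ((t : ℂ) - w)⁻¹ :=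
  hf.mul_bdd (c := |w.im|⁻¹) (continuous_resolvent hw).aestronglyMeasurable
    (Eventually.of_forall fun t => norm_resolvent_le hw t)

theorem tendsto_integral_of_eLpNorm_sub {ι : Type*} {l : Filter ι} {u : ι → ℝ → ℂ} {f : ℝ → ℂ}
    (hf : Integrable f) (hu : ∀ᶠ i in l, Integrable (u i))
    (h : Tendsto (fun i => eLpNorm (fun x => u i x - f x) 1 volume) l (𝓝 0)) :
    Tendsto (fun i => ∫ x, u i x) l (𝓝 (∫ x, f x)) := by
  refine tendsto_integral_of_L1 f hf.1 hu ?_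
  simpa only [eLpNorm_one_eq_lintegral_enorm] using h

theorem mul_self_eq_one_cases {σ : ℝ} (hσ : σ * σ = 1) : σ = 1 ∨ σ = -1 :=
  mul_self_eq_one_iff.1 hσ

theorem CauchyVanishes.comp_neg {σ : ℝ} {f : ℝ → ℂ} (hf : CauchyVanishes σ f) :
    CauchyVanishes (-σ) (fun t => f (-t)) := by
  intro w hw
  have h := hf (-w) (by simpa using hw)
  rw [← integral_neg_eq_self, ← neg_eq_zero, ← h, ← integral_neg]
  congr 1 with t
  simp only [neg_neg, Complex.ofReal_neg]
  rw [show -(t : ℂ) - w = -((t : ℂ) - -w) by ring, inv_neg]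
  ring

/-- A boundary function in `H_1^+` annihilates the Cauchy kernels: shift the line of integration
to infinity, where the additional decay of the kernel beats the bounded `L_1` norms. -/
theorem IsHardy.cauchyVanishes_one {f : ℝ → ℂ} (hf : IsHardy 1 1 f) : CauchyVanishes 1 f := by
  obtain ⟨hfm, F, hF, ⟨C, hC, hFC⟩, hFT⟩ := hf
  simp only [one_mul] at hF hFC hFT
  have hcont : ∀ y : ℝ, 0 < y → Continuous fun x : ℝ => F ((x : ℂ) + (y : ℂ) * Complex.I) :=
    fun y hy => hF.continuousOn.comp_continuous (by fun_prop) fun x => by simpa using hy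
  have hshift : ∀ (y : ℝ) (w : ℂ) (x : ℝ),
      (x : ℂ) + (y : ℂ) * Complex.I - w = (x : ℂ) - (w - (y : ℂ) * Complex.I) := fun y w x => by ring
  have hshift_im : ∀ (y : ℝ) (w : ℂ), (w - (y : ℂ) * Complex.I).im = w.im - y := by simp
  -- the kernel is at most `1 / (y - Im w)` on the line at height `y`
  have hker : ∀ (y : ℝ) (w : ℂ) (x : ℝ), w.im < y →
      ‖((x : ℂ) + (y : ℂ) * Complex.I - w)⁻¹‖ ≤ (y - w.im)⁻¹ := by
    intro y w x hw
    have h : w.im - y < 0 := by linarith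
    have := norm_resolvent_le (w := w - (y : ℂ) * Complex.I) (by rw [hshift_im]; exact h.ne) x
    rwa [hshift_im, abs_of_neg h, neg_sub, ← hshift] at this
  have hzero : ∀ w : ℂ, w.im < 0 → ∀ a : ℝ, 0 < a →
      ∫ x : ℝ, F ((x : ℂ) + (a : ℂ) * Complex.I) * ((x : ℂ) + (a : ℂ) * Complex.I - w)⁻¹ = 0 := by
    intro w hw a ha
    have hGd : DifferentiableOn ℂ (fun z => F z * (z - w)⁻¹) {z : ℂ | 0 < z.im} := by
      refine hF.mul (DifferentiableOn.inv (by fun_prop) fun z hz h => ?_)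
      rw [sub_eq_zero.1 h] at hz
      exact lt_asymm hw hz
    have hGC : ∀ y : ℝ, 0 < y → eLpNorm (fun x : ℝ => F ((x : ℂ) + (y : ℂ) * Complex.I) *
        ((x : ℂ) + (y : ℂ) * Complex.I - w)⁻¹) 1 volume ≤ ENNReal.ofReal (y - w.im)⁻¹ * C := by
      intro y hy
      refine (eLpNorm_le_mul_eLpNorm_of_ae_le_mul (Eventually.of_forall fun x => ?_) 1).trans
        (mul_le_mul_right (hFC y hy) _)
      rw [norm_mul, mul_comm]
      gcongr
      exact hker y w x (by linarith)
    have hconst : ∀ b : ℝ, a ≤ b → _ := fun b hb =>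
      integral_slice_eq (C := ENNReal.ofReal (0 - w.im)⁻¹ * C) hGd
        (ENNReal.mul_lt_top ENNReal.ofReal_lt_top hC)
        (fun y hy => (hGC y hy).trans (by gcongr)) ha hb
    have hle : ∀ b : ℝ, a ≤ b →
        ‖∫ x : ℝ, F ((x : ℂ) + (a : ℂ) * Complex.I) * ((x : ℂ) + (a : ℂ) * Complex.I - w)⁻¹‖ ≤
          (b - w.im)⁻¹ * C.toReal := by
      intro b hb
      have hb0 : 0 < b := ha.trans_le hb
      have hGm : AEStronglyMeasurable (fun x : ℝ => F ((x : ℂ) + (b : ℂ) * Complex.I) *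
          ((x : ℂ) + (b : ℂ) * Complex.I - w)⁻¹) volume := by
        refine ((hcont b hb0).mul (Continuous.inv₀ (by fun_prop) fun x => ?_)).aestronglyMeasurable
        rw [hshift]
        exact sub_ne_zero_of_im_ne_zero (by rw [hshift_im]; linarith) x
      rw [hconst b hb]
      refine (norm_integral_le_integral_norm _).trans ((integrable_of_eLpNorm_one_le
        (ENNReal.mul_lt_top ENNReal.ofReal_lt_top hC) hGm (hGC b hb0)).2.trans_eq ?_)
      rw [ENNReal.toReal_mul, ENNReal.toReal_ofReal (inv_nonneg.2 (by linarith))]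
    have hlim : Tendsto (fun b : ℝ => (b - w.im)⁻¹ * C.toReal) atTop (𝓝 0) := by
      simpa [sub_eq_add_neg] using (tendsto_inv_atTop_zero.comp
        (tendsto_atTop_add_const_right atTop (-w.im) tendsto_id)).mul_const C.toReal
    have h0 := ge_of_tendsto hlim ((eventually_ge_atTop a).mono hle)
    exact norm_le_zero_iff.1 h0
  intro w hw
  have hw' : w.im < 0 := by simpa using hw
  have hf := memLp_one_iff_integrable.1 hfm
  have hFi : ∀ y : ℝ, 0 < y → Integrable fun x : ℝ => F ((x : ℂ) + (y : ℂ) * Complex.I) :=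
    fun y hy => (integrable_of_eLpNorm_one_le hC (hcont y hy).aestronglyMeasurable (hFC y hy)).1
  have hlim : Tendsto
      (fun y : ℝ => ∫ x : ℝ, F ((x : ℂ) + (y : ℂ) * Complex.I) * ((x : ℂ) - w)⁻¹) (𝓝[>] 0)
      (𝓝 (∫ t : ℝ, f t * ((t : ℂ) - w)⁻¹)) := by
    refine tendsto_integral_of_eLpNorm_sub (integrable_mul_resolvent hf hw'.ne) ?_ ?_
    · filter_upwards [self_mem_nhdsWithin] with y hy
      exact integrable_mul_resolvent (hFi y hy) hw'.ne
    · have h0 := ENNReal.Tendsto.const_mul (a := ENNReal.ofReal |w.im|⁻¹) hFT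
        (Or.inr ENNReal.ofReal_ne_top)
      rw [mul_zero] at h0
      refine tendsto_of_tendsto_of_tendsto_of_le_of_le tendsto_const_nhds h0
        (fun _ => zero_le) fun y => ?_
      refine eLpNorm_le_mul_eLpNorm_of_ae_le_mul (Eventually.of_forall fun x => ?_) 1
      rw [← sub_mul, norm_mul, mul_comm]
      gcongr
      exact norm_resolvent_le hw'.ne x
  refine tendsto_nhds_unique hlim (tendsto_const_nhds.congr' ?_)
  -- for small `y` the pole `w + i y` still lies in the lower half-plane
  filter_upwards [Ioo_mem_nhdsGT (neg_pos.2 hw')] with y hy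
  have := hzero (w + (y : ℂ) * Complex.I) (by simpa using by linarith [hy.2]) y hy.1
  simpa only [add_sub_add_right_eq_sub] using this.symm

theorem CauchyVanishes.integral_eq_zero {σ : ℝ} (hσ : σ * σ = 1) {f : ℝ → ℂ} (hf : Integrable f)
    (h : CauchyVanishes σ f) : ∫ t, f t = 0 := by
  -- test against the kernels with poles `-σ s i`, multiplied by `σ s i`, and let `s → ∞`
  have hσ0 : σ ≠ 0 := by rintro rfl; simp at hσ
  set w : ℕ → ℂ := fun n => ((-(σ * (n + 1)) : ℝ) : ℂ) * Complex.I with hw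
  have hwim : ∀ n, (w n).im = -(σ * (n + 1)) := fun n => by simp [hw]
  have hwne : ∀ n, (w n).im ≠ 0 := fun n => by
    rw [hwim]
    exact neg_ne_zero.2 (mul_ne_zero hσ0 (by positivity))
  have hσ1 : |σ| = 1 := by
    rcases mul_self_eq_one_cases hσ with rfl | rfl <;> simp
  have hwabs : ∀ n : ℕ, |(w n).im| = n + 1 := fun n => by
    rw [hwim, abs_neg, abs_mul, hσ1, one_mul, abs_of_nonneg (by positivity)]
  have hwnorm : ∀ n : ℕ, ‖w n‖ = n + 1 := fun n => by
    rw [← hwabs, hwim]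
    simp only [hw, norm_mul, Complex.norm_I, mul_one, Complex.norm_real, Real.norm_eq_abs]
  have hlim : Tendsto (fun n => ∫ t : ℝ, -w n * (f t * ((t : ℂ) - w n)⁻¹)) atTop
      (𝓝 (∫ t, f t)) := by
    refine tendsto_integral_filter_of_dominated_convergence (fun t => ‖f t‖)
      (Eventually.of_forall fun n =>
        ((integrable_mul_resolvent hf (hwne n)).const_mul _).aestronglyMeasurable)
      (Eventually.of_forall fun n => Eventually.of_forall fun t => ?_) hf.norm
      (Eventually.of_forall fun t => ?_)
    · have := norm_resolvent_le (hwne n) t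
      rw [hwabs] at this
      calc ‖-w n * (f t * ((t : ℂ) - w n)⁻¹)‖ = ‖f t‖ * ((n + 1) * ‖((t : ℂ) - w n)⁻¹‖) := by
            rw [norm_mul, norm_mul, norm_neg, hwnorm]; ring
        _ ≤ ‖f t‖ * ((n + 1) * (n + 1 : ℝ)⁻¹) := by gcongr
        _ = ‖f t‖ := by rw [mul_inv_cancel₀ (by positivity), mul_one]
    · have h0 : Tendsto (fun n => ((t : ℂ) - w n)⁻¹) atTop (𝓝 0) := by
        refine squeeze_zero_norm (fun n => (norm_resolvent_le (hwne n) t).trans_eq ?_)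
          tendsto_one_div_add_atTop_nhds_zero_nat
        rw [hwabs, one_div]
      have h1 := (tendsto_const_nhds (x := f t)).sub (h0.const_mul (f t * t))
      rw [mul_zero, sub_zero] at h1
      refine h1.congr fun n => ?_
      have := sub_ne_zero_of_im_ne_zero (hwne n) t
      field_simp
      ring
  refine tendsto_nhds_unique hlim (tendsto_const_nhds.congr fun n => ?_)
  rw [integral_const_mul, h (w n) ?_, mul_zero]
  rw [hwim]
  have : (0 : ℝ) < n + 1 := by positivity
  nlinarith

theorem one_lt_conjExponent {p : ℝ≥0∞} (hp : p < ∞) : 1 < p.conjExponent := by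
  refine ENNReal.lt_add_right ENNReal.one_ne_top (ENNReal.inv_ne_zero.2 ?_)
  exact (tsub_le_self.trans_lt hp).ne

/-- Boundary functions of `H^p` annihilate Cauchy kernels: `f (t - w)⁻¹` is a boundary function in
`H^1` by Hölder's inequality, so its integral vanishes. -/
theorem IsHardy.cauchyVanishes {σ : ℝ} (hσ : σ * σ = 1) {p : ℝ≥0∞} (hp : 1 ≤ p) (hp' : p < ∞)
    {f : ℝ → ℂ} (hf : IsHardy σ p f) : CauchyVanishes σ f := by
  wlog h : σ = 1 generalizing σ f
  · obtain rfl := (mul_self_eq_one_cases hσ).resolve_left h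
    have := (this (by norm_num) hf.comp_neg (by norm_num)).comp_neg
    simpa using this
  subst h
  have hq : ENNReal.HolderConjugate p p.conjExponent := .conjExponent hp
  have hq1 := one_lt_conjExponent hp'
  intro w hw
  have hprod : IsHardy 1 1 (fun t => f t * ((t : ℂ) - w)⁻¹) :=
    hf.mul (q := p.conjExponent) hσ (IsHardy.resolvent hσ hw hq1)
  exact hprod.cauchyVanishes_one.integral_eq_zero hσ (memLp_one_iff_integrable.1 hprod.1)

/-! ### Poisson extension and the characterization of boundary functions -/

theorem eLpNorm_rpow_eq_lintegral {p : ℝ≥0∞} (hp : p ≠ 0) (hp' : p ≠ ∞) (u : ℝ → ℂ)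
    (μ : Measure ℝ) : eLpNorm u p μ ^ p.toReal = ∫⁻ x, ‖u x‖ₑ ^ p.toReal ∂μ := by
  rw [eLpNorm_eq_lintegral_rpow_enorm_toReal hp hp', ← ENNReal.rpow_mul,
    one_div_mul_cancel (ENNReal.toReal_pos hp hp').ne', ENNReal.rpow_one]

/-- Jensen's inequality and Tonelli's theorem: averaging over a probability measure. -/
theorem eLpNorm_integral_rpow_le {ν : Measure ℝ} [IsProbabilityMeasure ν] {p : ℝ≥0∞}
    (hp : 1 ≤ p) (hp' : p < ∞) {k : ℝ → ℝ → ℂ} (hk : StronglyMeasurable (Function.uncurry k)) :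
    eLpNorm (fun x => ∫ s, k x s ∂ν) p volume ^ p.toReal ≤
      ∫⁻ s, eLpNorm (fun x => k x s) p volume ^ p.toReal ∂ν := by
  have hp0 : p ≠ 0 := (zero_lt_one.trans_le hp).ne'
  have hpr : 0 < p.toReal := ENNReal.toReal_pos hp0 hp'.ne
  simp only [eLpNorm_rpow_eq_lintegral hp0 hp'.ne]
  rw [lintegral_lintegral_swap (f := fun s x => ‖k x s‖ₑ ^ p.toReal)]
  · refine lintegral_mono fun x => ?_
    have hm : AEStronglyMeasurable (k x) ν :=
      (hk.comp_measurable measurable_prodMk_left).aestronglyMeasurable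
    rw [← eLpNorm_rpow_eq_lintegral hp0 hp'.ne]
    gcongr
    refine (enorm_integral_le_lintegral_enorm _).trans ?_
    rw [← eLpNorm_one_eq_lintegral_enorm]
    exact eLpNorm_le_eLpNorm_of_exponent_le hp hm
  · exact ((hk.comp_measurable measurable_swap).enorm.pow_const _).aemeasurable

theorem eLpNorm_comp_add_right {p : ℝ≥0∞} {f : ℝ → ℂ} (h : ℝ) :
    eLpNorm (fun x => f (x + h)) p volume = eLpNorm f p volume := by
  conv_rhs => rw [← (measurePreserving_add_right volume h).map_eq]
  exact ((MeasurableEquiv.addRight h).measurableEmbedding.eLpNorm_map_measure).symm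

/-- Translations act continuously on `L_p(ℝ)`, `1 ≤ p < ∞`. -/
theorem tendsto_eLpNorm_translate_sub {p : ℝ≥0∞} (hp : 1 ≤ p) (hp' : p < ∞) {f : ℝ → ℂ}
    (hf : MemLp f p volume) :
    Tendsto (fun h : ℝ => eLpNorm (fun x => f (x + h) - f x) p volume) (𝓝 0) (𝓝 0) := by
  have : Fact (1 ≤ p) := ⟨hp⟩
  have : Fact (p ≠ ∞) := ⟨hp'.ne⟩
  have hc : Continuous fun h : ℝ => DomAddAct.mk h +ᵥ hf.toLp f :=
    DomAddAct.continuous_mk.vadd continuous_const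
  have h0 := (hc.edist continuous_const : Continuous fun h : ℝ =>
    edist (DomAddAct.mk h +ᵥ hf.toLp f) (hf.toLp f)).tendsto 0
  have e : ∀ h : ℝ, edist (DomAddAct.mk h +ᵥ hf.toLp f) (hf.toLp f) =
      eLpNorm (fun x => f (x + h) - f x) p volume := by
    intro h
    rw [DomAddAct.mk_vadd_toLp, Lp.edist_toLp_toLp]
    congr 1 with x
    simp [add_comm]
  simp only [e] at h0
  simpa using h0

theorem eLpNorm_average_le {ν : Measure ℝ} [IsProbabilityMeasure ν] {p : ℝ≥0∞} (hp : 1 ≤ p)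
    (hp' : p < ∞) {f : ℝ → ℂ} (hf : StronglyMeasurable f) (y : ℝ) :
    eLpNorm (fun x => ∫ s, f (x + y * s) ∂ν) p volume ≤ eLpNorm f p volume := by
  have hpr : 0 < p.toReal := ENNReal.toReal_pos (zero_lt_one.trans_le hp).ne' hp'.ne
  have h := eLpNorm_integral_rpow_le (ν := ν) hp hp' (k := fun x s => f (x + y * s))
    (hf.comp_measurable (by fun_prop))
  simp only [eLpNorm_comp_add_right, lintegral_const, measure_univ, mul_one] at h
  exact (ENNReal.rpow_le_rpow_iff hpr).1 h

/-- The dilates of any probability measure on `ℝ` form an approximate identity in `L_p(ℝ)`. -/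
theorem tendsto_eLpNorm_average_sub {ν : Measure ℝ} [IsProbabilityMeasure ν] {p : ℝ≥0∞}
    (hp : 1 ≤ p) (hp' : p < ∞) {f : ℝ → ℂ} (hf : StronglyMeasurable f) (hfp : MemLp f p volume)
    (hint : ∀ x y : ℝ, 0 < y → Integrable (fun s => f (x + y * s)) ν) :
    Tendsto (fun y => eLpNorm (fun x => (∫ s, f (x + y * s) ∂ν) - f x) p volume)
      (𝓝[>] 0) (𝓝 0) := by
  have hpr : 0 < p.toReal := ENNReal.toReal_pos (zero_lt_one.trans_le hp).ne' hp'.ne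
  set ω : ℝ → ℝ≥0∞ := fun h => eLpNorm (fun x => f (x + h) - f x) p volume ^ p.toReal with hω
  have hω0 : Tendsto ω (𝓝 0) (𝓝 0) := by
    have := (tendsto_eLpNorm_translate_sub hp hp' hfp).ennrpow_const p.toReal
    rwa [ENNReal.zero_rpow_of_pos hpr] at this
  have hωm : Measurable ω := by
    simp only [hω, eLpNorm_rpow_eq_lintegral (zero_lt_one.trans_le hp).ne' hp'.ne]
    have hm : StronglyMeasurable fun z : ℝ × ℝ => f (z.2 + z.1) - f z.2 :=
      (hf.comp_measurable (by fun_prop)).sub (hf.comp_measurable (by fun_prop))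
    exact (hm.enorm.pow_const p.toReal).lintegral_prod_right'
  have hωle : ∀ h, ω h ≤ (2 * eLpNorm f p volume) ^ p.toReal := by
    intro h
    simp only [hω]
    gcongr
    refine (eLpNorm_sub_le ?_ hf.aestronglyMeasurable hp).trans_eq ?_
    · exact (hf.comp_measurable (by fun_prop)).aestronglyMeasurable
    · rw [eLpNorm_comp_add_right, two_mul]
  have hlim : Tendsto (fun y : ℝ => ∫⁻ s, ω (y * s) ∂ν) (𝓝[>] 0) (𝓝 0) := by
    rw [← lintegral_zero (μ := ν)]
    refine tendsto_lintegral_filter_of_dominated_convergence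
      (fun _ => (2 * eLpNorm f p volume) ^ p.toReal)
      (Eventually.of_forall fun y => hωm.comp (by fun_prop))
      (Eventually.of_forall fun y => Eventually.of_forall fun s => hωle _) ?_
      (Eventually.of_forall fun s => ?_)
    · rw [lintegral_const, measure_univ, mul_one]
      exact ENNReal.rpow_ne_top_of_nonneg hpr.le
        (ENNReal.mul_ne_top ENNReal.ofNat_ne_top hfp.eLpNorm_ne_top)
    · refine hω0.comp (tendsto_nhdsWithin_of_tendsto_nhds ?_)
      simpa using (by fun_prop : Continuous fun y : ℝ => y * s).tendsto 0
  have hle : ∀ᶠ y : ℝ in 𝓝[>] 0,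
      eLpNorm (fun x => (∫ s, f (x + y * s) ∂ν) - f x) p volume ^ p.toReal ≤
        ∫⁻ s, ω (y * s) ∂ν := by
    filter_upwards [self_mem_nhdsWithin] with y hy
    refine le_trans (le_of_eq ?_) (eLpNorm_integral_rpow_le hp hp'
      (k := fun x s => f (x + y * s) - f x) ((hf.comp_measurable (by fun_prop)).sub
        (hf.comp_measurable (by fun_prop))))
    congr 2 with x
    rw [integral_sub (hint x y hy) (integrable_const _)]
    simp
  have h0 := (tendsto_of_tendsto_of_tendsto_of_le_of_le' tendsto_const_nhds hlim
    (Eventually.of_forall fun _ => zero_le) hle).ennrpow_const p.toReal⁻¹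
  rw [ENNReal.zero_rpow_of_pos (inv_pos.2 hpr)] at h0
  simpa only [ENNReal.rpow_rpow_inv hpr.ne'] using h0

theorem integrable_mul_resolvent_of_memLp {p : ℝ≥0∞} (hp : 1 ≤ p) (hp' : p < ∞) {f : ℝ → ℂ}
    (hf : MemLp f p volume) {w : ℂ} (hw : w.im ≠ 0) :
    Integrable fun t : ℝ => f t * ((t : ℂ) - w)⁻¹ := by
  have hq : ENNReal.HolderConjugate p p.conjExponent := .conjExponent hp
  exact memLp_one_iff_integrable.1
    ((memLp_resolvent hw (one_lt_conjExponent hp')).mul' (p := p) (r := 1) hf)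

/-- The Cauchy transform of `f`, analytic off the real line. -/
noncomputable def cauchyTransform (f : ℝ → ℂ) (z : ℂ) : ℂ :=
  (2 * Real.pi * Complex.I)⁻¹ * ∫ t : ℝ, f t * ((t : ℂ) - z)⁻¹

theorem differentiableOn_cauchyTransform {p : ℝ≥0∞} (hp : 1 ≤ p) (hp' : p < ∞) {f : ℝ → ℂ}
    (hf : MemLp f p volume) : DifferentiableOn ℂ (cauchyTransform f) {z : ℂ | 0 < z.im} := by
  intro z₀ hz₀
  replace hz₀ : 0 < z₀.im := hz₀
  refine DifferentiableAt.differentiableWithinAt (DifferentiableAt.const_mul ?_ _)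
  have hball : ∀ z ∈ Metric.ball z₀ (z₀.im / 2), z₀.im / 2 ≤ z.im := by
    intro z hz
    have h1 := (Complex.abs_im_le_norm (z - z₀)).trans_lt (mem_ball_iff_norm.1 hz)
    rw [Complex.sub_im] at h1
    linarith [neg_abs_le (z.im - z₀.im)]
  have hne : ∀ z ∈ Metric.ball z₀ (z₀.im / 2), z.im ≠ 0 := fun z hz =>
    ((half_pos hz₀).trans_le (hball z hz)).ne'
  have hcomp : ∀ z ∈ Metric.ball z₀ (z₀.im / 2), ∀ t : ℝ,
      ‖((t : ℂ) - z)⁻¹‖ ≤ 2 * ‖((t : ℂ) - z₀)⁻¹‖ := by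
    intro z hz t
    have h1 : 0 < ‖(t : ℂ) - z‖ := norm_pos_iff.2 (sub_ne_zero_of_im_ne_zero (hne z hz) t)
    have h2 : 0 < ‖(t : ℂ) - z₀‖ := norm_pos_iff.2 (sub_ne_zero_of_im_ne_zero hz₀.ne' t)
    have h3 : z₀.im / 2 ≤ ‖(t : ℂ) - z‖ :=
      (hball z hz).trans ((le_abs_self _).trans (abs_im_le_norm_ofReal_sub z t))
    have h4 : ‖(t : ℂ) - z₀‖ ≤ ‖(t : ℂ) - z‖ + ‖z - z₀‖ := norm_sub_le_norm_sub_add_norm_sub _ _ _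
    have h5 := mem_ball_iff_norm.1 hz
    rw [norm_inv, norm_inv, ← div_eq_mul_inv, inv_le_comm₀ h1 (by positivity), inv_div,
      div_le_iff₀ two_pos]
    linarith
  have hint := integrable_mul_resolvent_of_memLp hp hp' hf hz₀.ne'
  have key := hasDerivAt_integral_of_dominated_loc_of_deriv_le (μ := volume) (x₀ := z₀)
    (F := fun z (t : ℝ) => f t * ((t : ℂ) - z)⁻¹)
    (F' := fun z (t : ℝ) => f t * (((t : ℂ) - z)⁻¹ * ((t : ℂ) - z)⁻¹))
    (bound := fun t => (4 * |z₀.im|⁻¹) * ‖f t * ((t : ℂ) - z₀)⁻¹‖)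
    (Metric.ball_mem_nhds z₀ (half_pos hz₀)) ?_ hint ?_ ?_ (hint.norm.const_mul _) ?_
  · exact key.2.differentiableAt
  · filter_upwards [Metric.ball_mem_nhds z₀ (half_pos hz₀)] with z hz
    exact hf.1.mul (continuous_resolvent (hne z hz)).aestronglyMeasurable
  · exact hf.1.mul ((continuous_resolvent hz₀.ne').mul
      (continuous_resolvent hz₀.ne')).aestronglyMeasurable
  · refine Eventually.of_forall fun t z hz => ?_
    have h1 := hcomp z hz t
    have h2 := norm_resolvent_le hz₀.ne' t
    rw [norm_mul, norm_mul, norm_mul]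
    calc ‖f t‖ * (‖((t : ℂ) - z)⁻¹‖ * ‖((t : ℂ) - z)⁻¹‖)
        ≤ ‖f t‖ * ((2 * ‖((t : ℂ) - z₀)⁻¹‖) * (2 * |z₀.im|⁻¹)) := by
          gcongr
          exact h1.trans (by gcongr)
      _ = _ := by ring
  · refine Eventually.of_forall fun t z hz => ?_
    have h0 := sub_ne_zero_of_im_ne_zero (hne z hz) t
    have h1 := (((hasDerivAt_id z).const_sub (t : ℂ)).inv h0).const_mul (f t)
    refine h1.congr_deriv ?_
    simp only [neg_neg, one_div, id_eq, pow_two, mul_inv]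

theorem integral_cauchyMeasure (h : ℝ → ℂ) :
    ∫ s, h s ∂(ProbabilityTheory.cauchyMeasure 0 1) =
      ∫ s : ℝ, (((Real.pi⁻¹ * (s ^ 2 + 1)⁻¹ : ℝ)) : ℂ) * h s := by
  rw [ProbabilityTheory.cauchyMeasure_of_scale_ne_zero 0 one_ne_zero,
    integral_withDensity_eq_integral_toReal_smul (ProbabilityTheory.measurable_cauchyPDF 0 1)
      (Eventually.of_forall fun _ => ENNReal.ofReal_lt_top)]
  congr 1 with s
  rw [ProbabilityTheory.cauchyPDF_def, ENNReal.toReal_ofReal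
    (ProbabilityTheory.cauchyPDF_pos 0 one_ne_zero s).le, ProbabilityTheory.cauchyPDFReal_def,
    Complex.real_smul]
  simp

theorem integrable_cauchyMeasure {h : ℝ → ℂ}
    (hh : Integrable fun s : ℝ => (((s ^ 2 + 1)⁻¹ : ℝ) : ℂ) * h s) :
    Integrable h (ProbabilityTheory.cauchyMeasure 0 1) := by
  rw [ProbabilityTheory.cauchyMeasure_of_scale_ne_zero 0 one_ne_zero,
    integrable_withDensity_iff_integrable_smul' (ProbabilityTheory.measurable_cauchyPDF 0 1)
      (Eventually.of_forall fun _ => ENNReal.ofReal_lt_top)]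
  refine (hh.const_mul (Real.pi : ℂ)⁻¹).congr (Eventually.of_forall fun s => ?_)
  simp only
  rw [ProbabilityTheory.cauchyPDF_def, ENNReal.toReal_ofReal
    (ProbabilityTheory.cauchyPDF_pos 0 one_ne_zero s).le, ProbabilityTheory.cauchyPDFReal_def,
    Complex.real_smul]
  simp [mul_assoc]

/-- The product of the Cauchy kernels with poles `x ± i y` at `x + y s` is the Cauchy density in
`s`, up to a constant. -/
theorem resolvent_mul_resolvent_eq (x s y : ℝ) :
    (((x + y * s : ℝ) : ℂ) - ((x : ℂ) + (y : ℂ) * Complex.I))⁻¹ *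
      (((x + y * s : ℝ) : ℂ) - ((x : ℂ) - (y : ℂ) * Complex.I))⁻¹ =
      ((y ^ 2 : ℝ) : ℂ)⁻¹ * (((s ^ 2 + 1)⁻¹ : ℝ) : ℂ) := by
  push_cast
  rw [← mul_inv, ← mul_inv]
  congr 1
  linear_combination (-(y : ℂ) ^ 2) * Complex.I_sq

theorem integrable_poisson {p : ℝ≥0∞} (hp : 1 ≤ p) (hp' : p < ∞) {f : ℝ → ℂ}
    (hf : MemLp f p volume) (x : ℝ) {y : ℝ} (hy : 0 < y) :
    Integrable (fun s => f (x + y * s)) (ProbabilityTheory.cauchyMeasure 0 1) := by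
  refine integrable_cauchyMeasure ?_
  have him : ((x : ℂ) + (y : ℂ) * Complex.I).im ≠ 0 := by simpa using hy.ne'
  have him' : ((x : ℂ) - (y : ℂ) * Complex.I).im ≠ 0 := by simpa using hy.ne'
  have h1 : Integrable fun t : ℝ => f t * ((t : ℂ) - ((x : ℂ) + (y : ℂ) * Complex.I))⁻¹ *
      ((t : ℂ) - ((x : ℂ) - (y : ℂ) * Complex.I))⁻¹ :=
    integrable_mul_resolvent (integrable_mul_resolvent_of_memLp hp hp' hf him) him'
  refine (((h1.comp_add_left x).comp_mul_left' hy.ne').const_mul ((y ^ 2 : ℝ) : ℂ)).congr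
    (Eventually.of_forall fun s => ?_)
  simp only
  have hy' : ((y ^ 2 : ℝ) : ℂ) ≠ 0 := by
    exact_mod_cast (pow_pos hy 2).ne'
  rw [mul_assoc (f _), resolvent_mul_resolvent_eq x s y]
  field_simp

/-- For `f` annihilating the Cauchy kernels of the lower half-plane, the Cauchy transform is the
Poisson extension: subtract the (vanishing) value at the conjugate point. -/
theorem CauchyVanishes.cauchyTransform_eq {p : ℝ≥0∞} (hp : 1 ≤ p) (hp' : p < ∞) {f : ℝ → ℂ}
    (hf : MemLp f p volume) (h : CauchyVanishes 1 f) (x : ℝ) {y : ℝ} (hy : 0 < y) :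
    cauchyTransform f ((x : ℂ) + (y : ℂ) * Complex.I) =
      ∫ s, f (x + y * s) ∂(ProbabilityTheory.cauchyMeasure 0 1) := by
  have him : ((x : ℂ) + (y : ℂ) * Complex.I).im ≠ 0 := by simpa using hy.ne'
  have him' : ((x : ℂ) - (y : ℂ) * Complex.I).im ≠ 0 := by simpa using hy.ne'
  have h0 := h ((x : ℂ) - (y : ℂ) * Complex.I) (by simpa using hy)
  have hy0 : (y : ℂ) ≠ 0 := by exact_mod_cast hy.ne'
  have hpi : (Real.pi : ℂ) ≠ 0 := by exact_mod_cast Real.pi_ne_zero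
  rw [cauchyTransform, ← sub_zero (∫ t : ℝ, _), ← h0,
    ← integral_sub (integrable_mul_resolvent_of_memLp hp hp' hf him)
      (integrable_mul_resolvent_of_memLp hp hp' hf him'), integral_cauchyMeasure,
    ← integral_add_left_eq_self _ x, ← integral_const_mul]
  have hsub := Measure.integral_comp_mul_left (fun u : ℝ => (2 * Real.pi * Complex.I)⁻¹ *
    (f (x + u) * (((x + u : ℝ) : ℂ) - ((x : ℂ) + (y : ℂ) * Complex.I))⁻¹ -
    f (x + u) * (((x + u : ℝ) : ℂ) - ((x : ℂ) - (y : ℂ) * Complex.I))⁻¹)) y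
  rw [abs_of_pos (inv_pos.2 hy), eq_comm, inv_smul_eq_iff₀ hy.ne'] at hsub
  rw [hsub, ← integral_smul]
  congr 1 with s
  have h1 := sub_ne_zero_of_im_ne_zero him (x + y * s)
  have h2 := sub_ne_zero_of_im_ne_zero him' (x + y * s)
  have h3 := resolvent_mul_resolvent_eq x s y
  have h4 : (((x + y * s : ℝ) : ℂ) - ((x : ℂ) + (y : ℂ) * Complex.I))⁻¹ -
      (((x + y * s : ℝ) : ℂ) - ((x : ℂ) - (y : ℂ) * Complex.I))⁻¹ =
      2 * (y : ℂ) * Complex.I * (((y ^ 2 : ℝ) : ℂ)⁻¹ * (((s ^ 2 + 1)⁻¹ : ℝ) : ℂ)) := by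
    rw [← h3]
    field_simp
    ring
  rw [← mul_sub, h4, Complex.real_smul]
  push_cast
  field_simp

theorem CauchyVanishes.congr {σ : ℝ} {f g : ℝ → ℂ} (hf : CauchyVanishes σ f)
    (h : f =ᵐ[volume] g) : CauchyVanishes σ g := fun w hw => by
  rw [← hf w hw]
  refine integral_congr_ae ?_
  filter_upwards [h] with t ht
  rw [ht]

theorem cauchyTransform_congr {f g : ℝ → ℂ} (h : f =ᵐ[volume] g) :
    cauchyTransform f = cauchyTransform g := by
  funext z
  unfold cauchyTransform
  congr 1
  refine integral_congr_ae ?_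
  filter_upwards [h] with t ht
  rw [ht]

/-- The Cauchy transform of a function in `L_p` annihilating the Cauchy kernels of the lower
half-plane has horizontal slices bounded in `L_p` and converging to the function. -/
theorem CauchyVanishes.eLpNorm_cauchyTransform {p : ℝ≥0∞} (hp : 1 ≤ p) (hp' : p < ∞)
    {f : ℝ → ℂ} (hf : MemLp f p volume) (h : CauchyVanishes 1 f) :
    (∀ y : ℝ, 0 < y → eLpNorm (fun x : ℝ => cauchyTransform f ((x : ℂ) + (y : ℂ) * Complex.I)) p
        volume ≤ eLpNorm f p volume) ∧
    Tendsto (fun y : ℝ =>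
        eLpNorm (fun x : ℝ => cauchyTransform f ((x : ℂ) + (y : ℂ) * Complex.I) - f x) p volume)
      (𝓝[>] 0) (𝓝 0) := by
  wlog hsm : StronglyMeasurable f generalizing f
  · have hae := hf.1.ae_eq_mk
    have := this (hf.ae_eq hae) (h.congr hae) hf.1.stronglyMeasurable_mk
    rw [← cauchyTransform_congr hae, ← eLpNorm_congr_ae hae] at this
    refine ⟨this.1, this.2.congr fun y => eLpNorm_congr_ae ?_⟩
    filter_upwards [hae] with x hx
    rw [← hx]
  constructor
  · intro y hy
    simp only [h.cauchyTransform_eq hp hp' hf _ hy]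
    exact eLpNorm_average_le hp hp' hsm y
  · refine (tendsto_eLpNorm_average_sub hp hp' hsm hf
      (fun x y hy => integrable_poisson hp hp' hf x hy)).congr' ?_
    filter_upwards [self_mem_nhdsWithin] with y hy
    simp only [h.cauchyTransform_eq hp hp' hf _ hy]

/-- Characterization of boundary functions: the converse of `IsHardy.cauchyVanishes`. -/
theorem CauchyVanishes.isHardy {σ : ℝ} (hσ : σ * σ = 1) {p : ℝ≥0∞} (hp : 1 ≤ p) (hp' : p < ∞)
    {f : ℝ → ℂ} (hf : MemLp f p volume) (h : CauchyVanishes σ f) : IsHardy σ p f := by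
  wlog hs : σ = 1 generalizing σ f
  · obtain rfl := (mul_self_eq_one_cases hσ).resolve_left hs
    have := (this (by norm_num)
      (hf.comp_measurePreserving (Measure.measurePreserving_neg volume)) h.comp_neg
      (by norm_num)).comp_neg
    simpa using this
  subst hs
  obtain ⟨h1, h2⟩ := h.eLpNorm_cauchyTransform hp hp' hf
  refine ⟨hf, cauchyTransform f, ?_, ⟨_, hf.eLpNorm_lt_top, ?_⟩, ?_⟩
  · simpa only [one_mul] using differentiableOn_cauchyTransform hp hp' hf
  · simpa only [one_mul] using h1
  · simpa only [one_mul] using h2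

/-- `H_1^+ ∩ H_1^- = {0}`. -/
theorem ae_eq_zero_of_cauchyVanishes {f : ℝ → ℂ} (hf : Integrable f) (h : CauchyVanishes 1 f)
    (h' : CauchyVanishes (-1) f) : f =ᵐ[volume] 0 := by
  have hlim := (h.eLpNorm_cauchyTransform le_rfl ENNReal.one_lt_top
    (memLp_one_iff_integrable.2 hf)).2
  have h0 : ∀ᶠ y : ℝ in 𝓝[>] 0, eLpNorm f 1 volume = eLpNorm (fun x : ℝ =>
      cauchyTransform f ((x : ℂ) + (y : ℂ) * Complex.I) - f x) 1 volume := by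
    filter_upwards [self_mem_nhdsWithin] with y hy
    rw [← eLpNorm_neg]
    congr 1 with x
    rw [cauchyTransform, h' _ (by simpa using hy)]
    simp
  have := tendsto_nhds_unique (tendsto_const_nhds.congr' h0) hlim
  exact (eLpNorm_eq_zero_iff hf.1 one_ne_zero).1 this

/-- A boundary function of `H^q` that lies in `L_p` is a boundary function of `H^p`. -/
theorem IsHardy.of_memLp {σ : ℝ} (hσ : σ * σ = 1) {p q : ℝ≥0∞} (hp : 1 ≤ p) (hp' : p < ∞)
    (hq : 1 ≤ q) (hq' : q < ∞) {f : ℝ → ℂ} (hf : IsHardy σ q f) (hfp : MemLp f p volume) :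
    IsHardy σ p f :=
  (hf.cauchyVanishes hσ hq hq').isHardy hσ hp hp' hfp

/-! ### The homogeneous Riemann–Hilbert problem in `H_1` -/

theorem ofReal_add_I_ne_zero (ξ : ℝ) : (ξ : ℂ) + Complex.I ≠ 0 := by
  simpa using sub_ne_zero_of_im_ne_zero (w := -Complex.I) (by simp) ξ

theorem ofReal_sub_I_ne_zero (ξ : ℝ) : (ξ : ℂ) - Complex.I ≠ 0 :=
  sub_ne_zero_of_im_ne_zero (w := Complex.I) (by simp) ξ

theorem r_ne_zero (ξ : ℝ) : r ξ ≠ 0 :=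
  div_ne_zero (ofReal_sub_I_ne_zero ξ) (ofReal_add_I_ne_zero ξ)

theorem r_eq_one_sub (ξ : ℝ) : r ξ = 1 - 2 * Complex.I * ((ξ : ℂ) + Complex.I)⁻¹ := by
  have := ofReal_add_I_ne_zero ξ
  rw [r]
  field_simp
  ring

theorem r_neg (ξ : ℝ) : r (-ξ) = (r ξ)⁻¹ := by
  have h1 := ofReal_add_I_ne_zero ξ
  have h2 := ofReal_sub_I_ne_zero ξ
  have h3 : -(ξ : ℂ) + Complex.I ≠ 0 := by
    rw [show -(ξ : ℂ) + Complex.I = -((ξ : ℂ) - Complex.I) by ring]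
    exact neg_ne_zero.2 h2
  rw [r, r, inv_div, Complex.ofReal_neg]
  field_simp
  ring

theorem isHardy_inv_add_I {s : ℝ≥0∞} (hs : 1 < s) :
    IsHardy 1 s fun ξ : ℝ => ((ξ : ℂ) + Complex.I)⁻¹ := by
  simpa using IsHardy.resolvent (σ := 1) (by norm_num) (w := -Complex.I) (by simp) hs

/-- Polynomials in `r` are boundary functions of bounded analytic functions. -/
theorem isHardy_eval_r (R : Polynomial ℂ) : IsHardy 1 ∞ fun ξ => R.eval (r ξ) := by
  have hr : IsHardy 1 ∞ r := by
    refine ((IsHardy.const 1 1).add (by norm_num)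
      ((isHardy_inv_add_I (s := ∞) (by simp)).smul (-(2 * Complex.I)))).congr
      (Eventually.of_forall fun ξ => ?_)
    rw [r_eq_one_sub]
    simp [sub_eq_add_neg]
  induction R using Polynomial.induction_on with
  | C a => simpa using IsHardy.const 1 a
  | add p q hp hq => simpa using! hp.add (by norm_num) hq
  | monomial n a h =>
    refine (h.mul (q := ∞) (s := ∞) (by norm_num) hr).congr (Eventually.of_forall fun ξ => ?_)
    simp [pow_succ, mul_assoc]

theorem isHardy_eval_r_inv (R : Polynomial ℂ) : IsHardy (-1) ∞ fun ξ => R.eval (r ξ)⁻¹ := by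
  simpa only [r_neg] using (isHardy_eval_r R).comp_neg

theorem isHardy_inv_add_I_sq : IsHardy 1 1 fun ξ : ℝ => ((ξ : ℂ) + Complex.I)⁻¹ ^ 2 := by
  simpa only [pow_two] using IsHardy.mul (by norm_num) (p := 2) (q := 2) (s := 1)
    (isHardy_inv_add_I (by norm_num)) (isHardy_inv_add_I (by norm_num))

/-- Division by the Blaschke factor `r` of a function in `H_1^+` whose analytic extension vanishes
at `i`. -/
theorem IsHardy.mul_r_inv {u : ℝ → ℂ} (hu : IsHardy 1 1 u)
    (h : ∫ t : ℝ, u t * ((t : ℂ) - Complex.I)⁻¹ = 0) : IsHardy 1 1 fun t => u t * (r t)⁻¹ := by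
  have hui := memLp_one_iff_integrable.1 hu.1
  refine CauchyVanishes.isHardy (by norm_num) le_rfl ENNReal.one_lt_top ?_ fun w hw => ?_
  · have hr : MemLp (fun t => (r t)⁻¹) ∞ volume := by
      simpa using (isHardy_eval_r_inv Polynomial.X).1
    exact hr.mul' (p := 1) (r := 1) hu.1
  · have hw' : w.im < 0 := by simpa using hw
    have hiw : Complex.I - w ≠ 0 := by
      intro h0
      have := congrArg Complex.im h0
      simp at this
      linarith
    -- partial fractions
    have e : ∀ t : ℝ, u t * (r t)⁻¹ * ((t : ℂ) - w)⁻¹ =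
        2 * Complex.I / (Complex.I - w) * (u t * ((t : ℂ) - Complex.I)⁻¹) -
          (w + Complex.I) / (Complex.I - w) * (u t * ((t : ℂ) - w)⁻¹) := by
      intro t
      have h1 := ofReal_add_I_ne_zero t
      have h2 := ofReal_sub_I_ne_zero t
      have h3 := sub_ne_zero_of_im_ne_zero hw'.ne t
      rw [r, inv_div]
      field_simp
      ring
    simp only [e]
    rw [integral_sub ((integrable_mul_resolvent hui (by simp)).const_mul _)
      ((integrable_mul_resolvent hui hw'.ne).const_mul _), integral_const_mul, integral_const_mul,
      h, hu.cauchyVanishes_one w hw]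
    simp

theorem integral_inv_add_I_sq_mul :
    ∫ t : ℝ, ((t : ℂ) + Complex.I)⁻¹ ^ 2 * ((t : ℂ) - Complex.I)⁻¹ =
      Real.pi / (2 * Complex.I) := by
  have hH := isHardy_inv_add_I_sq
  have hi := memLp_one_iff_integrable.1 hH.1
  have e : ∀ t : ℝ, ((t : ℂ) + Complex.I)⁻¹ ^ 2 * ((t : ℂ) - Complex.I)⁻¹ =
      (2 * Complex.I)⁻¹ * ((((1 + t ^ 2)⁻¹ : ℝ) : ℂ) - ((t : ℂ) + Complex.I)⁻¹ ^ 2) := by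
    intro t
    have h1 := ofReal_add_I_ne_zero t
    have h2 := ofReal_sub_I_ne_zero t
    have h3 : (1 + (t : ℂ) ^ 2) = ((t : ℂ) + Complex.I) * ((t : ℂ) - Complex.I) := by
      linear_combination Complex.I_sq
    push_cast
    rw [h3]
    field_simp
    ring
  have hpi : Integrable fun t : ℝ => (((1 + t ^ 2)⁻¹ : ℝ) : ℂ) := integrable_inv_one_add_sq.ofReal
  have hpi' : ∫ t : ℝ, (((1 + t ^ 2)⁻¹ : ℝ) : ℂ) = Real.pi := by
    rw [← integral_univ_inv_one_add_sq]
    exact integral_ofReal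
  simp only [e]
  rw [integral_const_mul, integral_sub hpi hi, hpi',
    hH.cauchyVanishes_one.integral_eq_zero (by norm_num) hi]
  rw [sub_zero, mul_comm, div_eq_mul_inv]

/-- Solutions of the homogeneous Riemann–Hilbert problem `u = r^(n+1) v` with `u ∈ H_1^+` and
`v ∈ H_1^-`. Each step of the induction removes one zero of `u` at `i`, after subtracting the
multiple of `(ξ + i)⁻²` that has the same value at `i`. -/
theorem exists_polynomial_of_eq_r_pow_mul (n : ℕ) {u v : ℝ → ℂ} (hu : IsHardy 1 1 u)
    (hv : IsHardy (-1) 1 v) (huv : u =ᵐ[volume] fun ξ => r ξ ^ (n + 1) * v ξ) :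
    ∃ R ∈ Polynomial.degreeLT ℂ n,
      u =ᵐ[volume] fun ξ => R.eval (r ξ) * ((ξ : ℂ) + Complex.I)⁻¹ ^ 2 := by
  induction n generalizing u v with
  | zero =>
    refine ⟨0, zero_mem _, ?_⟩
    have hui := memLp_one_iff_integrable.1 hu.1
    have hvi := memLp_one_iff_integrable.1 hv.1
    have hu0 := hu.cauchyVanishes_one.integral_eq_zero (by norm_num) hui
    have hvc := hv.cauchyVanishes (by norm_num) le_rfl ENNReal.one_lt_top
    have hv0 := hvc.integral_eq_zero (by norm_num) hvi
    -- `u - v = (r - 1) v = -2i (ξ - i)⁻¹ u`, and both `u` and `v` have integral zero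
    have h0 : ∫ t : ℝ, u t * ((t : ℂ) - Complex.I)⁻¹ = 0 := by
      have h1 : ∫ t : ℝ, (u t - v t) = 0 := by rw [integral_sub hui hvi, hu0, hv0, sub_zero]
      have h2 : (fun t : ℝ => u t - v t) =ᵐ[volume]
          fun t => -(2 * Complex.I) * (u t * ((t : ℂ) - Complex.I)⁻¹) := by
        filter_upwards [huv] with t ht
        have e1 := ofReal_add_I_ne_zero t
        have e2 := ofReal_sub_I_ne_zero t
        rw [ht, r, zero_add, pow_one]
        field_simp
        ring
      rw [integral_congr_ae h2, integral_const_mul] at h1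
      simpa using h1
    have hvu : (fun t => u t * (r t)⁻¹) =ᵐ[volume] v := by
      filter_upwards [huv] with t ht
      have := r_ne_zero t
      rw [ht, zero_add, pow_one]
      field_simp
    have hv' := ((hu.mul_r_inv h0).congr hvu).cauchyVanishes_one
    filter_upwards [huv, ae_eq_zero_of_cauchyVanishes hvi hv' hvc] with t ht1 ht2
    simp [ht1, ht2]
  | succ m ih =>
    have hui := memLp_one_iff_integrable.1 hu.1
    have hei := memLp_one_iff_integrable.1 isHardy_inv_add_I_sq.1
    set e : ℝ → ℂ := fun ξ => ((ξ : ℂ) + Complex.I)⁻¹ ^ 2 with he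
    have hpi : (Real.pi : ℂ) ≠ 0 := by exact_mod_cast Real.pi_ne_zero
    obtain ⟨c, hc⟩ : ∃ c : ℂ, ∫ t : ℝ, u t * ((t : ℂ) - Complex.I)⁻¹ =
        c * ∫ t : ℝ, e t * ((t : ℂ) - Complex.I)⁻¹ := by
      refine ⟨_, (div_mul_cancel₀ _ ?_).symm⟩
      rw [integral_inv_add_I_sq_mul]
      exact div_ne_zero hpi (by simp)
    have hu1 : IsHardy 1 1 (u + (-c) • e) := hu.add (by norm_num) (isHardy_inv_add_I_sq.smul _)
    have h0 : ∫ t : ℝ, (u + (-c) • e) t * ((t : ℂ) - Complex.I)⁻¹ = 0 := by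
      have e1 : ∀ t : ℝ, (u + (-c) • e) t * ((t : ℂ) - Complex.I)⁻¹ =
          u t * ((t : ℂ) - Complex.I)⁻¹ - c * (e t * ((t : ℂ) - Complex.I)⁻¹) := by
        intro t
        simp only [Pi.add_apply, Pi.smul_apply, smul_eq_mul]
        ring
      simp only [e1]
      rw [integral_sub (integrable_mul_resolvent hui (by simp))
        ((integrable_mul_resolvent hei (by simp)).const_mul _), integral_const_mul, hc, sub_self]
    have hv1 : IsHardy (-1) 1 (v + (-c) • fun ξ => e (-ξ) * r (-ξ) ^ m) := by
      refine hv.add (by norm_num) (IsHardy.smul _ ?_)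
      have := (isHardy_inv_add_I_sq.mul (q := ∞) (s := 1) (by norm_num)
        (isHardy_eval_r (Polynomial.X ^ m))).comp_neg
      simpa [he] using this
    obtain ⟨R, hR, hRu⟩ := ih (hu1.mul_r_inv h0) hv1 (by
      filter_upwards [huv] with ξ hξ
      have e1 := ofReal_add_I_ne_zero ξ
      have e2 := ofReal_sub_I_ne_zero ξ
      have e3 : e (-ξ) = ((ξ : ℂ) - Complex.I)⁻¹ ^ 2 := by
        simp only [he, Complex.ofReal_neg]
        rw [show -(ξ : ℂ) + Complex.I = -((ξ : ℂ) - Complex.I) by ring, inv_neg, neg_sq]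
      have e4 : e ξ = r ξ ^ 2 * ((ξ : ℂ) - Complex.I)⁻¹ ^ 2 := by
        simp only [he, r]
        field_simp
      have e5 := r_ne_zero ξ
      simp only [Pi.add_apply, Pi.smul_apply, smul_eq_mul, hξ, e3, e4, r_neg, inv_pow]
      field_simp
      ring)
    refine ⟨Polynomial.C c + Polynomial.X * R, ?_, ?_⟩
    · rw [Polynomial.mem_degreeLT] at hR ⊢
      rw [Polynomial.degree_lt_iff_coeff_zero] at hR ⊢
      intro k hk
      obtain ⟨k, rfl⟩ : ∃ l, k = l + 1 := ⟨k - 1, by omega⟩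
      rw [Polynomial.coeff_add, Polynomial.coeff_C_succ, Polynomial.coeff_X_mul, zero_add]
      exact hR k (by omega)
    · filter_upwards [hRu] with ξ hξ
      have e5 := r_ne_zero ξ
      simp only [Pi.add_apply, Pi.smul_apply, smul_eq_mul] at hξ
      rw [mul_inv_eq_iff_eq_mul₀ e5] at hξ
      simp only [Polynomial.eval_add, Polynomial.eval_C, Polynomial.eval_mul, Polynomial.eval_X]
      linear_combination hξ

/-! ### Model spaces as polynomials in `r` -/

theorem isWeightedHardy_one_iff {p : ℝ≥0∞} {f : ℝ → ℂ} :
    IsWeightedHardy 1 p f ↔ IsHardy 1 p fun ξ => f ξ * ((ξ : ℂ) + Complex.I)⁻¹ := by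
  constructor
  · rintro ⟨h, hh, hf⟩
    refine hh.congr ?_
    filter_upwards [hf] with ξ hξ
    have := ofReal_add_I_ne_zero ξ
    rw [hξ, Complex.ofReal_one, one_mul]
    field_simp
  · refine fun h => ⟨_, h, Eventually.of_forall fun ξ => ?_⟩
    have := ofReal_add_I_ne_zero ξ
    simp only [Complex.ofReal_one, one_mul]
    field_simp

theorem isWeightedHardy_neg_one_iff {p : ℝ≥0∞} {f : ℝ → ℂ} :
    IsWeightedHardy (-1) p f ↔ IsHardy (-1) p fun ξ => f ξ * ((ξ : ℂ) - Complex.I)⁻¹ := by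
  have e : ∀ ξ : ℝ, (ξ : ℂ) + ((-1 : ℝ) : ℂ) * Complex.I = (ξ : ℂ) - Complex.I := by
    intro ξ
    push_cast
    ring
  constructor
  · rintro ⟨h, hh, hf⟩
    refine hh.congr ?_
    filter_upwards [hf] with ξ hξ
    have := ofReal_sub_I_ne_zero ξ
    rw [hξ, e]
    field_simp
  · refine fun h => ⟨_, h, Eventually.of_forall fun ξ => ?_⟩
    have := ofReal_sub_I_ne_zero ξ
    simp only [e]
    field_simp

theorem mem_toeplitzKer {p : ℝ≥0∞} {g : ℝ → ℂ} {φ : Lp ℂ p (volume : Measure ℝ)} :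
    φ ∈ toeplitzKer p g ↔ IsHardy 1 p φ ∧ IsHardy (-1) p fun ξ => g ξ * φ ξ := by
  constructor
  · rintro ⟨hφ, h, hh, -, h2⟩
    have h2' : h - 0 ∈ hardyMinus p := h2
    rw [sub_zero] at h2'
    exact ⟨hφ, IsHardy.congr h2' hh⟩
  · rintro ⟨hφ, h⟩
    refine ⟨hφ, h.1.toLp _, h.1.coeFn_toLp, zero_mem _, ?_⟩
    have : h.1.toLp _ ∈ hardyMinus p := h.congr h.1.coeFn_toLp.symm
    simpa using this

theorem r_injective : Function.Injective r := by
  intro a b h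
  rw [r_eq_one_sub, r_eq_one_sub] at h
  have h1 : ((a : ℂ) + Complex.I)⁻¹ = ((b : ℂ) + Complex.I)⁻¹ :=
    mul_left_cancel₀ (a := 2 * Complex.I) (by simp) (sub_right_injective h)
  exact_mod_cast add_right_cancel (inv_injective h1)

theorem eq_zero_of_eval_r_ae_eq_zero {R : Polynomial ℂ}
    (h : ∀ᵐ ξ : ℝ, R.eval (r ξ) = 0) : R = 0 := by
  refine Polynomial.eq_zero_of_infinite_isRoot R ?_
  have hinf : {ξ : ℝ | R.eval (r ξ) = 0}.Infinite := by
    intro hfin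
    have h0 : volume (Set.univ : Set ℝ) = 0 := by
      rw [← Set.union_compl_self {ξ : ℝ | R.eval (r ξ) = 0}]
      exact measure_union_null (hfin.measure_zero _) h
    simp at h0
  refine (hinf.image r_injective.injOn).mono ?_
  rintro _ ⟨ξ, hξ, rfl⟩
  exact hξ

/-- The model space `K_{r^n}` consists of the functions `R(r) / (ξ + i)` with `R` a polynomial of
degree less than `n`. -/
theorem mem_modelSpace {n : ℕ} {κ : ℝ → ℂ} : κ ∈ modelSpace n ↔
    ∃ R ∈ Polynomial.degreeLT ℂ n, κ = fun ξ : ℝ => ((ξ : ℂ) + Complex.I)⁻¹ * R.eval (r ξ) := by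
  set L : Polynomial ℂ →ₗ[ℂ] (ℝ → ℂ) :=
    { toFun := fun R (ξ : ℝ) => ((ξ : ℂ) + Complex.I)⁻¹ * R.eval (r ξ)
      map_add' := fun R S => by ext ξ; simp [mul_add]
      map_smul' := fun c R => by ext ξ; simp [mul_left_comm] } with hL
  have : modelSpace n = (Polynomial.degreeLT ℂ n).map L := by
    classical
    rw [Polynomial.degreeLT_eq_span_X_pow, Submodule.map_span, modelSpace]
    congr 1
    ext κ
    simp only [Set.mem_range, Finset.coe_image, Finset.coe_range, Set.image_image, Set.mem_image,
      Set.mem_Iio]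
    constructor
    · rintro ⟨j, rfl⟩
      exact ⟨j, j.2, by ext ξ; simp [hL]⟩
    · rintro ⟨j, hj, rfl⟩
      exact ⟨⟨j, hj⟩, by ext ξ; simp [hL]⟩
  rw [this, Submodule.mem_map]
  exact exists_congr fun R => and_congr_right fun _ => eq_comm

/-- A description of `M` by polynomials in `r` amounts to `M = w K_{r^n}`, and it gives the
dimension because `R ↦ w R(r) / (ξ + i)` is injective when `w` is non-zero almost everywhere. -/
theorem eqMulSpace_modelSpace_and_rank_eq {p : ℝ≥0∞} {M : Submodule ℂ (Lp ℂ p (volume : Measure ℝ))}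
    {w : ℝ → ℂ} (hw : ∀ᵐ ξ : ℝ, w ξ ≠ 0) {n : ℕ}
    (h1 : ∀ φ ∈ M, ∃ R ∈ Polynomial.degreeLT ℂ n,
      φ =ᵐ[volume] fun ξ => w ξ * (((ξ : ℂ) + Complex.I)⁻¹ * R.eval (r ξ)))
    (h2 : ∀ R ∈ Polynomial.degreeLT ℂ n, ∃ φ ∈ M,
      φ =ᵐ[volume] fun ξ => w ξ * (((ξ : ℂ) + Complex.I)⁻¹ * R.eval (r ξ))) :
    EqMulSpace M w (modelSpace n) ∧ Module.rank ℂ M = (n : Cardinal) := by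
  constructor
  · ext f
    constructor
    · rintro ⟨φ, hφ, hf⟩
      obtain ⟨R, hR, hRφ⟩ := h1 φ hφ
      exact ⟨_, mem_modelSpace.2 ⟨R, hR, rfl⟩, hf.trans hRφ⟩
    · rintro ⟨κ, hκ, hf⟩
      obtain ⟨R, hR, rfl⟩ := mem_modelSpace.1 hκ
      obtain ⟨φ, hφ, hRφ⟩ := h2 R hR
      exact ⟨φ, hφ, hf.trans hRφ.symm⟩
  · choose T hTM hT using h2
    set L : Polynomial.degreeLT ℂ n →ₗ[ℂ] Lp ℂ p (volume : Measure ℝ) :=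
      { toFun := fun R => T R R.2
        map_add' := fun R S => by
          refine Lp.ext ?_
          filter_upwards [hT _ (R + S).2, hT _ R.2, hT _ S.2, Lp.coeFn_add (T R R.2) (T S S.2)]
            with ξ e1 e2 e3 e4
          rw [e1, e4, Pi.add_apply, e2, e3, Submodule.coe_add, Polynomial.eval_add]
          ring
        map_smul' := fun c R => by
          refine Lp.ext ?_
          filter_upwards [hT _ (c • R).2, hT _ R.2, Lp.coeFn_smul c (T R R.2)] with ξ e1 e2 e3
          rw [e1, RingHom.id_apply, e3, Pi.smul_apply, e2, Submodule.coe_smul,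
            Polynomial.eval_smul, smul_eq_mul, smul_eq_mul]
          ring } with hL
    have hinj : Function.Injective L := by
      rw [← LinearMap.ker_eq_bot, LinearMap.ker_eq_bot']
      intro R hR
      refine Subtype.ext (eq_zero_of_eval_r_ae_eq_zero ?_)
      have h0 : T R R.2 = 0 := hR
      filter_upwards [hT _ R.2, hw, Lp.coeFn_zero ℂ p (volume : Measure ℝ)] with ξ e1 e2 e3
      rw [h0, e3] at e1
      simpa [e2, ofReal_add_I_ne_zero ξ] using e1.symm
    have hrange : LinearMap.range L = M := by
      ext φ
      constructor
      · rintro ⟨R, rfl⟩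
        exact hTM R R.2
      · intro hφ
        obtain ⟨R, hR, hRφ⟩ := h1 φ hφ
        exact ⟨⟨R, hR⟩, Lp.ext ((hT R hR).trans hRφ.symm)⟩
    rw [← hrange, ← (LinearEquiv.ofInjective L hinj).rank_eq,
      (Polynomial.degreeLTEquiv ℂ n).rank_eq, rank_fin_fun]

theorem eval_r_X_sub_C_one_mul (S : Polynomial ℂ) (ξ : ℝ) :
    ((Polynomial.X - Polynomial.C 1) * S).eval (r ξ) =
      -(2 * Complex.I) * (((ξ : ℂ) + Complex.I)⁻¹ * S.eval (r ξ)) := by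
  simp only [Polynomial.eval_mul, Polynomial.eval_sub, Polynomial.eval_X, Polynomial.eval_C]
  rw [show r ξ - 1 = -(2 * Complex.I) * ((ξ : ℂ) + Complex.I)⁻¹ by rw [r_eq_one_sub]; ring]
  ring

theorem X_sub_C_mul_mem_degreeLT_succ {S : Polynomial ℂ} {a : ℂ} {m : ℕ} :
    (Polynomial.X - Polynomial.C a) * S ∈ Polynomial.degreeLT ℂ (m + 1) ↔
      S ∈ Polynomial.degreeLT ℂ m := by
  rcases eq_or_ne S 0 with rfl | hS
  · simp
  · rw [Polynomial.mem_degreeLT, Polynomial.mem_degreeLT, Polynomial.degree_mul,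
      Polynomial.degree_X_sub_C, Polynomial.degree_eq_natDegree hS]
    norm_cast
    omega

/-- Multiplication by `R(r)` with `R(1) = 0` improves integrability: `R(r)` is then a multiple of
`1 - r = 2i / (ξ + i)`, which lies in every `L_s`, `s > 1`. -/
theorem memLp_mul_eval_r_of_isRoot {p q : ℝ≥0∞} (hp : 1 < p) (hpq : p ≤ q) {h : ℝ → ℂ}
    (hh : MemLp h q volume) {R : Polynomial ℂ} (hR : R.IsRoot 1) :
    MemLp (fun ξ => h ξ * R.eval (r ξ)) p volume := by
  obtain ⟨S, rfl⟩ := Polynomial.dvd_iff_isRoot.2 hR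
  set s : ℝ≥0∞ := (p⁻¹ - q⁻¹)⁻¹ with hs
  have hs1 : 1 < s := by
    rw [hs, ENNReal.one_lt_inv]
    exact tsub_le_self.trans_lt (ENNReal.inv_lt_one.2 hp)
  have hT : ENNReal.HolderTriple q s p :=
    ⟨by rw [hs, inv_inv, add_tsub_cancel_of_le (ENNReal.inv_le_inv.2 hpq)]⟩
  have h1 : MemLp (fun ξ : ℝ => h ξ * ((ξ : ℂ) + Complex.I)⁻¹) p volume :=
    (isHardy_inv_add_I hs1).1.mul' (p := q) (r := p) hh
  have h2 : MemLp (fun ξ : ℝ => h ξ * ((ξ : ℂ) + Complex.I)⁻¹ * S.eval (r ξ)) p volume :=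
    (isHardy_eval_r S).1.mul' (p := p) (r := p) h1
  refine (h2.const_mul (-(2 * Complex.I))).ae_eq (Eventually.of_forall fun ξ => ?_)
  simp only [eval_r_X_sub_C_one_mul]
  ring

/-- If `R(1) ≠ 0` no integrability is lost on division by `R(r)`, although `R(r)` may have zeros:
`R(1) h` is the difference of `h R(r)` and `h (R - R(1))(r)`. -/
theorem memLp_of_memLp_mul_eval_r {p q : ℝ≥0∞} (hp : 1 < p) (hpq : p ≤ q) {h : ℝ → ℂ}
    (hh : MemLp h q volume) {R : Polynomial ℂ} (hR : ¬ R.IsRoot 1)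
    (hhR : MemLp (fun ξ => h ξ * R.eval (r ξ)) p volume) : MemLp h p volume := by
  have h1 := memLp_mul_eval_r_of_isRoot hp hpq hh
    (R := R - Polynomial.C (R.eval 1)) (by simp [Polynomial.IsRoot])
  refine ((hhR.sub h1).const_mul (R.eval 1)⁻¹).ae_eq (Eventually.of_forall fun ξ => ?_)
  have hR' : R.eval 1 ≠ 0 := hR
  simp only [Pi.sub_apply, Polynomial.eval_sub, Polynomial.eval_C]
  field_simp
  ring

/-! ### The kernel of the Toeplitz operator -/

theorem memLp_mul_eval_r {p : ℝ≥0∞} {h : ℝ → ℂ} (hh : MemLp h p volume) (R : Polynomial ℂ) :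
    MemLp (fun ξ => h ξ * R.eval (r ξ)) p volume :=
  (isHardy_eval_r R).1.mul' (p := p) (r := p) hh

theorem memLp_mul_r_inv_pow {p : ℝ≥0∞} {h : ℝ → ℂ} (hh : MemLp h p volume) (m : ℕ) :
    MemLp (fun ξ => h ξ * (r ξ)⁻¹ ^ m) p volume := by
  have := (isHardy_eval_r_inv (Polynomial.X ^ m)).1.mul' (p := p) (r := p) hh
  simpa using this

/-- If `R` has degree at most `m`, then `R(r) r^(-m)` is a polynomial in `r⁻¹`. -/
theorem exists_eval_r_inv_eq {m : ℕ} {R : Polynomial ℂ}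
    (hR : R ∈ Polynomial.degreeLT ℂ (m + 1)) :
    ∃ S : Polynomial ℂ, ∀ ξ, R.eval (r ξ) * (r ξ)⁻¹ ^ m = S.eval (r ξ)⁻¹ := by
  refine ⟨R.reflect m, fun ξ => ?_⟩
  have hdeg : R.natDegree ≤ m := by
    rw [Polynomial.mem_degreeLT, Polynomial.degree_lt_iff_coeff_zero] at hR
    rw [Polynomial.natDegree_le_iff_coeff_eq_zero]
    exact fun k hk => hR k hk
  have := invertibleOfNonzero (r_ne_zero ξ)
  have h := Polynomial.eval₂_reflect_mul_pow (RingHom.id ℂ) (r ξ) m R hdeg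
  rw [invOf_eq_inv] at h
  simp only [Polynomial.eval₂_id] at h
  rw [← h, mul_assoc, ← mul_pow, mul_inv_cancel₀ (r_ne_zero ξ), one_pow, mul_one]

section Factorization

variable {p p' q : ℝ≥0∞} {g gm gp : ℝ → ℂ} {k : ℤ}

/-- For `φ ∈ ker T_g` the functions `u = g_+ φ / (ξ + i) ∈ H_1^+` and
`v = g_-⁻¹ g φ / (ξ - i) ∈ H_1^-` satisfy `u = r^(1-k) v`. -/
theorem IsFactorization.exists_polynomial_of_mem_toeplitzKer
    (hpp' : p⁻¹ + p'⁻¹ = 1) (hg : IsFactorization q p' g gm k gp)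
    {φ : Lp ℂ p (volume : Measure ℝ)} (hφ : φ ∈ toeplitzKer p g) :
    ∃ R ∈ Polynomial.degreeLT ℂ (-k).toNat,
      φ =ᵐ[volume] fun ξ => (gp ξ)⁻¹ * ((ξ : ℂ) + Complex.I)⁻¹ * R.eval (r ξ) := by
  obtain ⟨h1, h2⟩ := mem_toeplitzKer.1 hφ
  have hT : ENNReal.HolderTriple p' p 1 := ⟨by rw [inv_one, add_comm, hpp']⟩
  have hu : IsHardy 1 1 _ := (isWeightedHardy_one_iff.1 hg.plus_mem).mul (s := 1) (by norm_num) h1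
  have hv : IsHardy (-1) 1 _ :=
    (isWeightedHardy_neg_one_iff.1 hg.minus_inv_mem).mul (s := 1) (by norm_num) h2
  have hv' : IsHardy (-1) 1 _ := hv.mul (q := ∞) (s := 1) (by norm_num)
    (isHardy_eval_r_inv (Polynomial.X ^ k.toNat))
  obtain ⟨R, hR, hRu⟩ := exists_polynomial_of_eq_r_pow_mul (-k).toNat hu hv' (by
    filter_upwards [hg.eq_mul, hg.minus_ne_zero] with ξ e1 e2
    have e3 := ofReal_add_I_ne_zero ξ
    have e4 := ofReal_sub_I_ne_zero ξ
    have e5 := r_ne_zero ξ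
    have e6 : ((ξ : ℂ) + Complex.I)⁻¹ = r ξ * ((ξ : ℂ) - Complex.I)⁻¹ := by
      rw [r]
      field_simp
    have e7 : r ξ ^ (-k).toNat * (r ξ)⁻¹ ^ k.toNat * r ξ ^ k = 1 := by
      rw [← zpow_natCast, ← zpow_natCast, inv_zpow', ← zpow_add₀ e5, ← zpow_add₀ e5]
      convert zpow_zero _ using 2
      omega
    simp only [Polynomial.eval_pow, Polynomial.eval_X, Pi.inv_apply, e1, e6]
    linear_combination (-(gp ξ * φ ξ * r ξ * ((ξ : ℂ) - Complex.I)⁻¹)) * e7 +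
      (-(gp ξ * φ ξ * r ξ * ((ξ : ℂ) - Complex.I)⁻¹ *
        (r ξ ^ (-k).toNat * (r ξ)⁻¹ ^ k.toNat * r ξ ^ k))) * inv_mul_cancel₀ e2)
  refine ⟨R, hR, ?_⟩
  filter_upwards [hRu, hg.plus_ne_zero] with ξ e1 e2
  have e3 := ofReal_add_I_ne_zero ξ
  field_simp at e1 ⊢
  linear_combination e1

variable {m : ℕ} {R : Polynomial ℂ} {φ : Lp ℂ p (volume : Measure ℝ)}

/-- On the functions `φ = g_+⁻¹ R(r) / (ξ + i)`, multiplication by `g` gives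
`g_- R(r) r^(-m) / (ξ - i)` with `m = |k| - 1`. -/
theorem IsFactorization.mul_eq (hg : IsFactorization q p' g gm (-(m + 1 : ℕ)) gp)
    (hφR : φ =ᵐ[volume] fun ξ => (gp ξ)⁻¹ * ((ξ : ℂ) + Complex.I)⁻¹ * R.eval (r ξ)) :
    (fun ξ => g ξ * φ ξ) =ᵐ[volume]
      fun ξ => gm ξ * ((ξ : ℂ) - Complex.I)⁻¹ * (R.eval (r ξ) * (r ξ)⁻¹ ^ m) := by
  filter_upwards [hg.eq_mul, hg.plus_ne_zero, hφR] with ξ e1 e2 e3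
  have e4 := ofReal_add_I_ne_zero ξ
  have e5 := ofReal_sub_I_ne_zero ξ
  have e6 := r_ne_zero ξ
  have e7 : ((ξ : ℂ) + Complex.I)⁻¹ = r ξ * ((ξ : ℂ) - Complex.I)⁻¹ := by
    rw [r]
    field_simp
  rw [e1, e3, e7, zpow_neg, zpow_natCast, pow_succ, inv_pow]
  field_simp

theorem IsFactorization.memLp_of_mem_toeplitzKer
    (hg : IsFactorization q p' g gm (-(m + 1 : ℕ)) gp)
    (hφR : φ =ᵐ[volume] fun ξ => (gp ξ)⁻¹ * ((ξ : ℂ) + Complex.I)⁻¹ * R.eval (r ξ))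
    (hφ : φ ∈ toeplitzKer p g) :
    MemLp (fun ξ : ℝ => gm ξ * ((ξ : ℂ) - Complex.I)⁻¹ * R.eval (r ξ)) p volume := by
  refine (memLp_mul_eval_r (mem_toeplitzKer.1 hφ).2.1 (Polynomial.X ^ m)).ae_eq ?_
  filter_upwards [hg.mul_eq hφR] with ξ e1
  have e6 := r_ne_zero ξ
  rw [e1, Polynomial.eval_pow, Polynomial.eval_X, inv_pow]
  field_simp

theorem IsFactorization.mem_toeplitzKer_of_memLp (hp : 1 < p) (hpq : p ≤ q)
    (hg : IsFactorization q p' g gm (-(m + 1 : ℕ)) gp)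
    (hR : R ∈ Polynomial.degreeLT ℂ (m + 1))
    (hφR : φ =ᵐ[volume] fun ξ => (gp ξ)⁻¹ * ((ξ : ℂ) + Complex.I)⁻¹ * R.eval (r ξ))
    (h : MemLp (fun ξ : ℝ => gm ξ * ((ξ : ℂ) - Complex.I)⁻¹ * R.eval (r ξ)) p volume) :
    φ ∈ toeplitzKer p g := by
  have hp' : p < ∞ := hpq.trans_lt hg.left_lt_top
  obtain ⟨S, hS⟩ := exists_eval_r_inv_eq hR
  have hplus : IsHardy 1 q φ :=
    ((isWeightedHardy_one_iff.1 hg.plus_inv_mem).mul (q := ∞) (s := q) (by norm_num)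
      (isHardy_eval_r R)).congr hφR.symm
  have hminus : IsHardy (-1) q fun ξ => g ξ * φ ξ := by
    refine ((isWeightedHardy_neg_one_iff.1 hg.minus_mem).mul (q := ∞) (s := q) (by norm_num)
      (isHardy_eval_r_inv S)).congr ?_
    filter_upwards [hg.mul_eq hφR] with ξ e1
    rw [e1, hS]
  refine mem_toeplitzKer.2 ⟨hplus.of_memLp (by norm_num) hp.le hp' hg.one_lt_left.le
    hg.left_lt_top (Lp.memLp φ), hminus.of_memLp (by norm_num) hp.le hp' hg.one_lt_left.le
    hg.left_lt_top ((memLp_mul_r_inv_pow h m).ae_eq ?_)⟩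
  filter_upwards [hg.mul_eq hφR] with ξ e1
  rw [e1]
  ring

/-- If `g_- ∉ 𝓗_p^-` or `g_+⁻¹ ∉ 𝓗_p^+`, the polynomials describing the kernel vanish at `1`, the
value of `r` at infinity: otherwise `g_- / (ξ - i)` and `g_+⁻¹ / (ξ + i)` would lie in `L_p`. -/
theorem IsFactorization.isRoot_one_of_mem_toeplitzKer (hp : 1 < p) (hpq : p ≤ q)
    (hg : IsFactorization q p' g gm (-(m + 1 : ℕ)) gp)
    (hn : ¬ IsWeightedHardy (-1) p gm ∨ ¬ IsWeightedHardy 1 p gp⁻¹)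
    (hφR : φ =ᵐ[volume] fun ξ => (gp ξ)⁻¹ * ((ξ : ℂ) + Complex.I)⁻¹ * R.eval (r ξ))
    (hφ : φ ∈ toeplitzKer p g) : R.IsRoot 1 := by
  by_contra hR
  have hp' : p < ∞ := hpq.trans_lt hg.left_lt_top
  have hm := isWeightedHardy_neg_one_iff.1 hg.minus_mem
  have hpl := isWeightedHardy_one_iff.1 hg.plus_inv_mem
  rcases hn with hn | hn
  · exact hn (isWeightedHardy_neg_one_iff.2 (hm.of_memLp (by norm_num) hp.le hp'
      hg.one_lt_left.le hg.left_lt_top (memLp_of_memLp_mul_eval_r hp hpq hm.1 hR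
        (hg.memLp_of_mem_toeplitzKer hφR hφ))))
  · exact hn (isWeightedHardy_one_iff.2 (hpl.of_memLp (by norm_num) hp.le hp'
      hg.one_lt_left.le hg.left_lt_top (memLp_of_memLp_mul_eval_r hp hpq hpl.1 hR
        ((Lp.memLp φ).ae_eq hφR))))

end Factorization

theorem rank_eq_zero_of_eq_bot {p : ℝ≥0∞} {M : Submodule ℂ (Lp ℂ p (volume : Measure ℝ))}
    (h : M = ⊥) : M = ⊥ ∧ Module.rank ℂ M = 0 := by
  subst h
  exact ⟨rfl, rank_bot ℂ _⟩

theorem eq_bot_of_forall_ae_eq_zero {p : ℝ≥0∞} {M : Submodule ℂ (Lp ℂ p (volume : Measure ℝ))}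
    (h : ∀ φ ∈ M, φ =ᵐ[volume] (0 : ℝ → ℂ)) : M = ⊥ :=
  (Submodule.eq_bot_iff M).2 fun φ hφ => (Lp.eq_zero_iff_ae_eq_zero).2 (h φ hφ)

end UnboundedToeplitz

theorem theorem7p1 (p p' q : ℝ≥0∞) (hp : 1 < p) (hpq : p ≤ q) (hq : q < ∞)
    (hpp' : p⁻¹ + p'⁻¹ = 1) (g gm gp : ℝ → ℂ) (k : ℤ)
    (hg : UnboundedToeplitz.IsFactorization q p' g gm k gp) :
    ((UnboundedToeplitz.IsWeightedHardy (-1) p gm ∧ UnboundedToeplitz.IsWeightedHardy 1 p gp⁻¹) →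
      (0 ≤ k → UnboundedToeplitz.toeplitzKer p g = ⊥ ∧
        Module.rank ℂ (UnboundedToeplitz.toeplitzKer p g) = 0) ∧
      (k < 0 →
        UnboundedToeplitz.EqMulSpace (UnboundedToeplitz.toeplitzKer p g)
          (fun ξ => (gp ξ)⁻¹) (UnboundedToeplitz.modelSpace k.natAbs) ∧
        Module.rank ℂ (UnboundedToeplitz.toeplitzKer p g) = (k.natAbs : Cardinal))) ∧
    ((¬ UnboundedToeplitz.IsWeightedHardy (-1) p gm ∨
        ¬ UnboundedToeplitz.IsWeightedHardy 1 p gp⁻¹) →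
      (-1 ≤ k → UnboundedToeplitz.toeplitzKer p g = ⊥ ∧
        Module.rank ℂ (UnboundedToeplitz.toeplitzKer p g) = 0) ∧
      (k ≤ -2 →
        UnboundedToeplitz.EqMulSpace (UnboundedToeplitz.toeplitzKer p g)
          (fun ξ => (gp ξ)⁻¹ / ((ξ : ℂ) + Complex.I))
          (UnboundedToeplitz.modelSpace (k.natAbs - 1)) ∧
        Module.rank ℂ (UnboundedToeplitz.toeplitzKer p g) = ((k.natAbs - 1 : ℕ) : Cardinal))) := by
  open UnboundedToeplitz in
  have hdeg0 : ∀ R ∈ Polynomial.degreeLT ℂ 0, R = 0 := fun R hR =>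
    Polynomial.degree_eq_bot.1 (Nat.WithBot.lt_zero_iff.1 (Polynomial.mem_degreeLT.1 hR))
  have hnonneg : 0 ≤ k → toeplitzKer p g = ⊥ := by
    intro hk
    refine eq_bot_of_forall_ae_eq_zero fun φ hφ => ?_
    obtain ⟨R, hR, hφR⟩ := hg.exists_polynomial_of_mem_toeplitzKer hpp' hφ
    rw [Int.toNat_eq_zero.2 (by omega)] at hR
    have hR0 := hdeg0 R hR
    subst hR0
    filter_upwards [hφR] with ξ e
    simpa using e
  -- the case of negative index, in terms of `m = |k| - 1`
  have hneg : k < 0 → ∃ m : ℕ, k = -(m + 1 : ℕ) := fun hk => ⟨k.natAbs - 1, by omega⟩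
  refine ⟨fun ⟨hm, hpl⟩ => ⟨fun hk => rank_eq_zero_of_eq_bot (hnonneg hk), fun hk => ?_⟩,
    fun hn => ⟨fun hk => rank_eq_zero_of_eq_bot ?_, fun hk => ?_⟩⟩
  · obtain ⟨m, rfl⟩ := hneg hk
    rw [Int.natAbs_neg, Int.natAbs_natCast]
    refine eqMulSpace_modelSpace_and_rank_eq ?_ (fun φ hφ => ?_) fun R hR => ?_
    · filter_upwards [hg.plus_ne_zero] with ξ e using inv_ne_zero e
    · obtain ⟨R, hR, hφR⟩ := hg.exists_polynomial_of_mem_toeplitzKer hpp' hφ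
      rw [neg_neg, Int.toNat_natCast] at hR
      exact ⟨R, hR, by simpa only [mul_assoc] using hφR⟩
    · have hL := memLp_mul_eval_r (isWeightedHardy_one_iff.1 hpl).1 R
      refine ⟨hL.toLp _, hg.mem_toeplitzKer_of_memLp hp hpq hR hL.coeFn_toLp
        (memLp_mul_eval_r (isWeightedHardy_neg_one_iff.1 hm).1 R), ?_⟩
      simpa only [mul_assoc] using! hL.coeFn_toLp
  -- for `k = -1` the polynomials describing the kernel are constants that vanish at `1`
  · rcases le_or_gt 0 k with hk0 | hk0
    · exact hnonneg hk0
    · obtain ⟨m, rfl⟩ := hneg hk0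
      obtain rfl : m = 0 := by omega
      refine eq_bot_of_forall_ae_eq_zero fun φ hφ => ?_
      obtain ⟨R, hR, hφR⟩ := hg.exists_polynomial_of_mem_toeplitzKer hpp' hφ
      have hroot := hg.isRoot_one_of_mem_toeplitzKer hp hpq hn hφR hφ
      rw [neg_neg, Int.toNat_natCast] at hR
      obtain ⟨S, rfl⟩ := Polynomial.dvd_iff_isRoot.2 hroot
      have hS0 := hdeg0 S (X_sub_C_mul_mem_degreeLT_succ.1 hR)
      subst hS0
      filter_upwards [hφR] with ξ e
      simpa using e
  · obtain ⟨m, rfl⟩ := hneg (by omega)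
    rw [Int.natAbs_neg, Int.natAbs_natCast, Nat.add_sub_cancel]
    refine eqMulSpace_modelSpace_and_rank_eq ?_ (fun φ hφ => ?_) fun S hS => ?_
    · filter_upwards [hg.plus_ne_zero] with ξ e
      exact div_ne_zero (inv_ne_zero e) (ofReal_add_I_ne_zero ξ)
    · obtain ⟨R, hR, hφR⟩ := hg.exists_polynomial_of_mem_toeplitzKer hpp' hφ
      rw [neg_neg, Int.toNat_natCast] at hR
      obtain ⟨S, rfl⟩ := Polynomial.dvd_iff_isRoot.2
        (hg.isRoot_one_of_mem_toeplitzKer hp hpq hn hφR hφ)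
      refine ⟨-(2 * Complex.I) • S,
        Submodule.smul_mem _ _ (X_sub_C_mul_mem_degreeLT_succ.1 hR), ?_⟩
      filter_upwards [hφR] with ξ e
      rw [e, eval_r_X_sub_C_one_mul, Polynomial.eval_smul, smul_eq_mul]
      ring
    · set R := (Polynomial.X - Polynomial.C 1) * ((-(2 * Complex.I))⁻¹ • S) with hRdef
      have hR : R ∈ Polynomial.degreeLT ℂ (m + 1) :=
        X_sub_C_mul_mem_degreeLT_succ.2 (Submodule.smul_mem _ _ hS)
      have hroot : R.IsRoot 1 := Polynomial.dvd_iff_isRoot.1 (dvd_mul_right _ _)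
      have hL := memLp_mul_eval_r_of_isRoot hp hpq
        (isWeightedHardy_one_iff.1 hg.plus_inv_mem).1 hroot
      refine ⟨hL.toLp _, hg.mem_toeplitzKer_of_memLp hp hpq hR hL.coeFn_toLp
        (memLp_mul_eval_r_of_isRoot hp hpq
          (isWeightedHardy_neg_one_iff.1 hg.minus_mem).1 hroot), ?_⟩
      filter_upwards [hL.coeFn_toLp] with ξ e
      rw [e, hRdef, eval_r_X_sub_C_one_mul, Polynomial.eval_smul, smul_eq_mul, Pi.inv_apply]
      have h2 : -(2 * Complex.I) ≠ 0 := by simp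
      field_simp
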